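/- Let $\nu$ be a probability measure on the Borel sets of $\mathbb R$ and $p:\mathbb R\to(0,1)$ a measurable function with $\theta=\int_{\mathbb R}\frac{d\nu}{1-p}<\infty$. Let $(W_n)_{n\ge 0}$ be a Markov chain on a probability space $(\Omega,\mathcal A,P)$ with transition function $$Q(w;B)=p(w)\mathbf 1_B(w)+(1-p(w))\,\nu(B)$$ (from $w$ the chain stays at $w$ with probability $p(w)$, and otherwise jumps to a point drawn from $\nu$), started from its stationary (and reversing) distribution $d\pi=\frac{d\nu}{\theta(1-p)}$. Let $g\in L^2(\pi)$ with $\int g\,d\pi=0$, $X_k=g(W_k)$ and $S_n=X_1+\cdots+X_n$. Let $\tau_0<\tau_1<\tau_2<\cdots$ be the successive times just before the jumps of the chain, that is, the successive $n\ge 0$ for which the step from time $n$ to time $n+1$ is a jump (if $\nu$ has no atoms, this means almost surely $W_{n+1}\ne W_n$; in general the chain is realized, possibly on another probability space, together with the record of which steps are jumps). Put $Y_j=(\tau_j-\tau_{j-1})X_{\tau_j}$ for $j\ge1$; these are i.i.d. Let $H(y)=E\big[Y_1^2\,\mathbf 1_{\{|Y_1|\le y\}}\big]$, which does not depend on the realization.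 Suppose that $H$ varies slowly at infinity, that is, $H(y)>0$ for all large $y$ and $\lim_{y\to\infty}H(cy)/H(y)=1$ for every $c>0$. Let $\gamma_m$ be real numbers with $\gamma_m\to\infty$ and $\gamma_m^2\sim mH(\gamma_m)$ as $m\to\infty$. Then the conditional distribution of $S_n/\gamma_n$ given $W_0$ converges in probability, as $n\to\infty$, to the normal distribution with mean $0$ and variance $1/\theta$, in the space of probability measures on $\mathbb R$ with the topology of weak convergence. -/

import Mathlib

open MeasureTheory ProbabilityTheory Filter
open scoped Topology ENNReal Asymptotics

noncomputable section

namespace StayJump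

/-- `V 0, V 1, …` is a Markov chain on `(Ω, P)` with transition function `κ` and initial law `μ`:
given `V 0, …, V n`, the conditional law of `V (n + 1)` is `κ (V n)`. -/
structure IsMarkovChain {Ω E : Type*} [MeasurableSpace Ω] [MeasurableSpace E]
    (P : Measure Ω) (V : ℕ → Ω → E) (κ : Kernel E E) (μ : Measure E) : Prop where
  measurable : ∀ n, Measurable (V n)
  initial : P.map (V 0) = μ
  markov : ∀ (n : ℕ) (B : Set E), MeasurableSet B →
    P[(V (n + 1) ⁻¹' B).indicator (fun _ => (1 : ℝ)) |
        ⨆ k ∈ Set.Iic n, MeasurableSpace.comap (V k) inferInstance]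
      =ᵐ[P] fun ω => (κ (V n ω)).real B

/-- The transition function `Q(w; B) = p(w) 1_B(w) + (1 - p(w)) ν(B)`. -/
def stayOrJump (p : ℝ → ℝ) (hp : Measurable p) (ν : Measure ℝ) : Kernel ℝ ℝ where
  toFun w := ENNReal.ofReal (p w) • Measure.dirac w + ENNReal.ofReal (1 - p w) • ν
  measurable' := by
    refine Measure.measurable_of_measurable_coe _ fun B hB => ?_
    simp only [Measure.add_apply, Measure.smul_apply, smul_eq_mul]
    exact (hp.ennreal_ofReal.mul
      ((Measure.measurable_coe hB).comp Measure.measurable_dirac)).add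
      (((measurable_const.sub hp).ennreal_ofReal).mul measurable_const)

/-- The same step with a record of whether it was a jump: from `w`, with probability `p(w)` the
chain stays at `w` (mark `false`); with probability `1 - p(w)` it jumps, that is, it moves to a
fresh point drawn from `ν` (mark `true`). The mark of the current state plays no role. -/
def markedStayOrJump (p : ℝ → ℝ) (hp : Measurable p) (ν : Measure ℝ) :
    Kernel (ℝ × Bool) (ℝ × Bool) where
  toFun v := ENNReal.ofReal (p v.1) • Measure.dirac (v.1, false)
    + ENNReal.ofReal (1 - p v.1) • ν.map (fun z => (z, true))
  measurable' := by
    refine Measure.measurable_of_measurable_coe _ fun B hB => ?_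
    simp only [Measure.add_apply, Measure.smul_apply, smul_eq_mul]
    have hq : Measurable fun v : ℝ × Bool => p v.1 := hp.comp measurable_fst
    have hs : Measurable fun v : ℝ × Bool => (v.1, false) :=
      measurable_fst.prodMk measurable_const
    exact (hq.ennreal_ofReal.mul
      ((Measure.measurable_coe hB).comp (Measure.measurable_dirac.comp hs))).add
      (((measurable_const.sub hq).ennreal_ofReal).mul measurable_const)

/-- `θ = ∫ dν / (1 - p)`. -/
def theta (p : ℝ → ℝ) (ν : Measure ℝ) : ℝ := ∫ w, (1 - p w)⁻¹ ∂ν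

/-- The stationary distribution `dπ = dν / (θ (1 - p))`. -/
def stationaryLaw (p : ℝ → ℝ) (ν : Measure ℝ) : Measure ℝ :=
  ν.withDensity fun w => ENNReal.ofReal (theta p ν * (1 - p w))⁻¹

/-- The times before the process jumps, for a path `v` of the marked chain: `τ 0` is the first
`n ≥ 0` such that the step from `n` to `n + 1` is a jump, and `τ (k + 1)` is the first such
`n > τ k`. -/
def tau (v : ℕ → ℝ × Bool) : ℕ → ℕ
  | 0 => sInf {n | (v (n + 1)).2 = true}
  | k + 1 => sInf {n | tau v k < n ∧ (v (n + 1)).2 = true}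

/-- The block sum `Y_j = (τ_j - τ_{j-1}) g(W_{τ_j})`, meant for `j ≥ 1`. -/
def blockSum (g : ℝ → ℝ) (v : ℕ → ℝ × Bool) (j : ℕ) : ℝ :=
  ((tau v j : ℝ) - (tau v (j - 1) : ℝ)) * g (v (tau v j)).1

/-- `H(y) = ∫_{|Y_1| ≤ y} Y_1² dP` (the `Y_j`, `j ≥ 1`, all have the same law). -/
def truncatedMoment {Ω : Type*} [MeasurableSpace Ω] (P : Measure Ω)
    (V : ℕ → Ω → ℝ × Bool) (g : ℝ → ℝ) (y : ℝ) : ℝ :=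
  ∫ ω in {ω | |blockSum g (fun n => V n ω) 1| ≤ y}, (blockSum g (fun n => V n ω) 1) ^ 2 ∂P

/-- `ℓ` varies slowly at infinity. -/
def SlowlyVarying (l : ℝ → ℝ) : Prop :=
  (∀ᶠ y in atTop, 0 < l y) ∧ ∀ c : ℝ, 0 < c → Tendsto (fun y => l (c * y) / l y) atTop (𝓝 1)

/-- The partial sums `S_n = g(W_1) + ⋯ + g(W_n)`. -/
def partialSum {Ω : Type*} (g : ℝ → ℝ) (W : ℕ → Ω → ℝ) (n : ℕ) (ω : Ω) : ℝ :=
  ∑ k ∈ Finset.Icc 1 n, g (W k ω)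

/-- The conditional law of `Z n` given `X`, a random element of the space of probability measures
on `ℝ` with the topology of weak convergence, converges in probability to `G`. -/
def CondLawTendstoInProb {Ω : Type*} [MeasurableSpace Ω] (P : Measure Ω) [IsFiniteMeasure P]
    (X : Ω → ℝ) (Z : ℕ → Ω → ℝ) (G : ProbabilityMeasure ℝ) : Prop :=
  ∀ U ∈ 𝓝 G, Tendsto
    (fun n => P {ω | (⟨condDistrib (Z n) X P (X ω), inferInstance⟩ : ProbabilityMeasure ℝ) ∉ U})
    atTop (𝓝 0)

end StayJump

end

/-! Between jumps the chain does not move, so `S_n` is a sum of blocks (length) × `g`(landing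
point), the landing points being drawn from `ν` and the lengths geometric given the landing point.
The mean block length is `θ`, so about `n/θ` blocks fit into `n` steps. Since the blocks, normalized
by `γ_n`, obey a central limit theorem with variance 1 per `n` blocks, the limit variance is `1/θ`.

The proof works with characteristic functions and a renewal equation instead of counting blocks. Let
`φ` be the characteristic function of a block. Slow variation of `H` and mean zero give `n (φ(t/γ_n)
- 1) → -t²/2` (`tendsto_mul_charFun_sub_one`). Let `A(m)` be the characteristic function, at `s =
t/γ_n`, of the sum over the `m` steps following a jump. Conditioning on the next jump gives a
renewal equation for `A` (`jumpCharFun_succ`). With `β = t²/(2θ)`, the exponential `L(j) =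
exp(-βj/n)` satisfies it up to defects whose sum over `m < n` tends to 0: the first-order part of
each is `φ - 1 + βθ/n = o(1/n)`, and the remainder is handled by dominated convergence, with a
multiple of the block length as integrable bound. Stability of the equation
(`norm_sub_le_sum_of_renewal`) gives `A(j) - L(j) → 0` uniformly in `j ≤ n`.

From a fixed starting point the wait for the first jump is negligible, so the law of `S_n/γ_n`
converges for every starting point (`tendsto_charFun_sumKernel`). These laws are the conditional
laws given `W_0`, which therefore converge almost surely, hence in probability. -/

noncomputable section

namespace StayJump

/-! ### Truncated moments and the characteristic function of a law attracted to the normal. -/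

section AttractionToNormal

variable {μ : Measure ℝ}

lemma measurableSet_abs_le (y : ℝ) : MeasurableSet {x : ℝ | |x| ≤ y} :=
  measurableSet_le (by fun_prop) (by fun_prop)

lemma measurableSet_lt_abs (y : ℝ) : MeasurableSet {x : ℝ | y < |x|} :=
  measurableSet_lt (by fun_prop) (by fun_prop)

lemma integrableOn_abs_le_of_le [IsProbabilityMeasure μ] {f : ℝ → ℝ} (hf : Measurable f) {y C : ℝ}
    (h : ∀ x, |x| ≤ y → |f x| ≤ C) : IntegrableOn f {x : ℝ | |x| ≤ y} μ := by
  refine Measure.integrableOn_of_bounded (M := C) (measure_ne_top _ _)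
    hf.aestronglyMeasurable ?_
  filter_upwards [ae_restrict_mem (measurableSet_abs_le y)] with x hx
  exact h x hx

lemma integrableOn_sq_abs_le [IsProbabilityMeasure μ] (y : ℝ) : IntegrableOn (fun x => x ^ 2) {x : ℝ | |x| ≤ y} μ := by
  refine integrableOn_abs_le_of_le (C := y ^ 2) (by fun_prop) fun x hx => ?_
  rw [abs_of_nonneg (sq_nonneg x), ← sq_abs]
  gcongr

lemma integrableOn_abs_cube_abs_le [IsProbabilityMeasure μ] (y : ℝ) :
    IntegrableOn (fun x => |x| ^ 3) {x : ℝ | |x| ≤ y} μ := by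
  refine integrableOn_abs_le_of_le (C := y ^ 3) (by fun_prop) fun x hx => ?_
  rw [abs_of_nonneg (by positivity)]
  gcongr

lemma abs_le_union_shell {y z : ℝ} (hyz : y ≤ z) :
    {x : ℝ | |x| ≤ z} = {x : ℝ | |x| ≤ y} ∪ {x : ℝ | y < |x| ∧ |x| ≤ z} := by
  ext x
  simp only [Set.mem_ofPred_eq, Set.mem_union]
  constructor
  · intro h
    rcases le_or_gt |x| y with h' | h'
    · exact Or.inl h'
    · exact Or.inr ⟨h', h⟩
  · rintro (h | h)
    · exact h.trans hyz
    · exact h.2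

lemma measurableSet_shell (y z : ℝ) : MeasurableSet {x : ℝ | y < |x| ∧ |x| ≤ z} :=
  (measurableSet_lt_abs y).inter (measurableSet_abs_le z)

lemma disjoint_abs_le_shell (y z : ℝ) :
    Disjoint {x : ℝ | |x| ≤ y} {x : ℝ | y < |x| ∧ |x| ≤ z} :=
  Set.disjoint_left.2 fun _ h h' => absurd h'.1 (not_lt.2 h)

lemma setIntegral_shell {f : ℝ → ℝ} {y z : ℝ} (hyz : y ≤ z)
    (hf : IntegrableOn f {x : ℝ | |x| ≤ z} μ) :
    ∫ x in {x : ℝ | |x| ≤ z}, f x ∂μ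
      = ∫ x in {x : ℝ | |x| ≤ y}, f x ∂μ + ∫ x in {x : ℝ | y < |x| ∧ |x| ≤ z}, f x ∂μ := by
  rw [abs_le_union_shell hyz] at hf ⊢
  exact setIntegral_union (disjoint_abs_le_shell y z) (measurableSet_shell y z)
    (hf.mono_set Set.subset_union_left) (hf.mono_set Set.subset_union_right)

/-- One dyadic step: `|x| ≤ x²/y` on the shell `y < |x| ≤ 2y`. -/
lemma integral_tail_le [IsProbabilityMeasure μ] (hint : Integrable (fun x : ℝ => x) μ) {y : ℝ} (hy : 0 < y) :
    ∫ x in {x : ℝ | y < |x|}, |x| ∂μ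
      ≤ (∫ x in {x : ℝ | |x| ≤ 2 * y}, x ^ 2 ∂μ - ∫ x in {x : ℝ | |x| ≤ y}, x ^ 2 ∂μ) / y
        + ∫ x in {x : ℝ | 2 * y < |x|}, |x| ∂μ := by
  have hyz : y ≤ 2 * y := by linarith
  have hset : {x : ℝ | y < |x|} = {x : ℝ | y < |x| ∧ |x| ≤ 2 * y} ∪ {x : ℝ | 2 * y < |x|} := by
    ext x
    simp only [Set.mem_ofPred_eq, Set.mem_union]
    constructor
    · intro h
      rcases le_or_gt |x| (2 * y) with h' | h'
      · exact Or.inl ⟨h, h'⟩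
      · exact Or.inr h'
    · rintro (h | h)
      · exact h.1
      · linarith
  have hdisj : Disjoint {x : ℝ | y < |x| ∧ |x| ≤ 2 * y} {x : ℝ | 2 * y < |x|} :=
    Set.disjoint_left.2 fun _ h h' => absurd h' (not_lt.2 h.2)
  rw [hset, setIntegral_union hdisj (measurableSet_lt_abs _) hint.abs.integrableOn
    hint.abs.integrableOn, setIntegral_shell hyz (integrableOn_sq_abs_le _), add_sub_cancel_left]
  gcongr
  rw [← integral_div]
  refine setIntegral_mono_on hint.abs.integrableOn ?_ (measurableSet_shell _ _) fun x hx => ?_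
  · exact ((integrableOn_sq_abs_le (2 * y)).mono_set fun x hx => hx.2).div_const _
  · rw [le_div_iff₀ hy, ← sq_abs, sq]
    exact mul_le_mul_of_nonneg_left hx.1.le (abs_nonneg x)

lemma tendsto_integral_tail (hint : Integrable (fun x : ℝ => x) μ) :
    Tendsto (fun y => ∫ x in {x : ℝ | y < |x|}, |x| ∂μ) atTop (𝓝 0) := by
  have h := tendsto_integral_filter_of_dominated_convergence (μ := μ) (l := (atTop : Filter ℝ))
    (F := fun y x => {x : ℝ | y < |x|}.indicator (fun x => |x|) x) (f := fun _ => 0)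
    (fun x => |x|)
    (Eventually.of_forall fun y =>
      (hint.abs.indicator (measurableSet_lt_abs y)).aestronglyMeasurable)
    (Eventually.of_forall fun y => Eventually.of_forall fun x => ?_) hint.abs
    (Eventually.of_forall fun x => ?_)
  · simpa [integral_indicator (measurableSet_lt_abs _)] using h
  · refine (norm_indicator_le_norm_self _ _).trans (by simp)
  · refine tendsto_const_nhds.congr' ?_
    filter_upwards [eventually_ge_atTop |x|] with y hy
    rw [Set.indicator_of_notMem]
    simpa using hy

/-- The dyadic step is iterated. Slow variation makes each increment of `H` at most `δH`, and `H(2^k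
y)/(2^k y)` decays geometrically because doubling the argument multiplies `H` by at most 3/2. -/
lemma tendsto_mul_integral_tail_div [IsProbabilityMeasure μ] (hint : Integrable (fun x : ℝ => x) μ)
    (hH : SlowlyVarying fun y => ∫ x in {x : ℝ | |x| ≤ y}, x ^ 2 ∂μ) :
    Tendsto (fun y => y * (∫ x in {x : ℝ | y < |x|}, |x| ∂μ)
      / ∫ x in {x : ℝ | |x| ≤ y}, x ^ 2 ∂μ) atTop (𝓝 0) := by
  set H : ℝ → ℝ := fun y => ∫ x in {x : ℝ | |x| ≤ y}, x ^ 2 ∂μ with hHdef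
  set T : ℝ → ℝ := fun y => ∫ x in {x : ℝ | y < |x|}, |x| ∂μ with hTdef
  have hT0 : ∀ y, 0 ≤ T y := fun y => setIntegral_nonneg (measurableSet_lt_abs y)
    fun x _ => abs_nonneg x
  rw [Metric.tendsto_atTop]
  intro ε hε
  obtain ⟨δ, hδ0, hδ1, hδε⟩ : ∃ δ : ℝ, 0 < δ ∧ δ ≤ 1 / 2 ∧ 4 * δ < ε :=
    ⟨min (1 / 2) (ε / 8), by positivity, min_le_left _ _,
      by have := min_le_right (1 / 2) (ε / 8); linarith⟩
  have hev : ∀ᶠ y in atTop, 0 < H y ∧ H (2 * y) < (1 + δ) * H y ∧ 1 ≤ y := by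
    filter_upwards [hH.1, (hH.2 2 two_pos).eventually_lt_const (show (1 : ℝ) < 1 + δ by linarith),
      eventually_ge_atTop 1] with y h1 h2 h3
    exact ⟨h1, (div_lt_iff₀ h1).1 h2, h3⟩
  obtain ⟨y0, hy0⟩ := eventually_atTop.1 hev
  -- The constant `4δ` reproduces itself: `δ + 4δ · (3/2)/2 = 4δ`.
  have key : ∀ N : ℕ, ∀ y, y0 ≤ y → T y ≤ 4 * δ * H y / y + T (2 ^ N * y) := by
    intro N
    induction N with
    | zero =>
      intro y hy
      obtain ⟨h1, -, h3⟩ := hy0 y hy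
      have : 0 ≤ 4 * δ * H y / y := by positivity
      simpa using this
    | succ N ih =>
      intro y hy
      obtain ⟨h1, h2, h3⟩ := hy0 y hy
      have hy' : 0 < y := by linarith
      have hstep : T y ≤ (H (2 * y) - H y) / y + T (2 * y) := integral_tail_le hint hy'
      have hih := ih (2 * y) (by linarith)
      rw [show 2 ^ (N + 1) * y = 2 ^ N * (2 * y) by ring]
      have h4 : (H (2 * y) - H y) / y ≤ δ * H y / y := by
        gcongr
        linarith
      have h5 : 4 * δ * H (2 * y) / (2 * y) ≤ 3 * δ * H y / y := by
        rw [div_le_div_iff₀ (by positivity) hy']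
        have : H (2 * y) ≤ 3 / 2 * H y := by nlinarith
        have h6 : 4 * δ * H (2 * y) ≤ 4 * δ * (3 / 2 * H y) := by gcongr
        nlinarith
      have h7 : δ * H y / y + 3 * δ * H y / y = 4 * δ * H y / y := by ring
      linarith
  refine ⟨y0, fun y hy => ?_⟩
  obtain ⟨h1, -, h3⟩ := hy0 y hy
  have hy' : 0 < y := by linarith
  have hlim : Tendsto (fun N : ℕ => 4 * δ * H y / y + T (2 ^ N * y)) atTop
      (𝓝 (4 * δ * H y / y + 0)) := by
    refine tendsto_const_nhds.add ((tendsto_integral_tail hint).comp ?_)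
    exact (tendsto_pow_atTop_atTop_of_one_lt one_lt_two).atTop_mul_const hy'
  have hTy : T y ≤ 4 * δ * H y / y := by
    simpa using ge_of_tendsto' hlim fun N => key N y hy
  rw [Real.dist_eq, sub_zero, abs_of_nonneg (by have := hT0 y; positivity), div_lt_iff₀ h1]
  calc y * T y ≤ y * (4 * δ * H y / y) := by gcongr
    _ = 4 * δ * H y := by field_simp
    _ < ε * H y := by gcongr

/-- Split at `a y` with `a` small: below, `|x|³ ≤ a y x²`; on the shell up to `y`, `|x|³ ≤ y x²`,
and the shell carries only `o(H(y))` of the second moment. -/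
lemma tendsto_integral_abs_cube_div [IsProbabilityMeasure μ] 
    (hH : SlowlyVarying fun y => ∫ x in {x : ℝ | |x| ≤ y}, x ^ 2 ∂μ) :
    Tendsto (fun y => (∫ x in {x : ℝ | |x| ≤ y}, |x| ^ 3 ∂μ)
      / (y * ∫ x in {x : ℝ | |x| ≤ y}, x ^ 2 ∂μ)) atTop (𝓝 0) := by
  set H : ℝ → ℝ := fun y => ∫ x in {x : ℝ | |x| ≤ y}, x ^ 2 ∂μ with hHdef
  have hbound : ∀ {a y : ℝ}, 0 < a → a ≤ 1 → 0 < y →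
      ∫ x in {x : ℝ | |x| ≤ y}, |x| ^ 3 ∂μ ≤ a * y * H (a * y) + y * (H y - H (a * y)) := by
    intro a y ha ha1 hy
    have hyz : a * y ≤ y := by nlinarith
    rw [setIntegral_shell hyz (integrableOn_abs_cube_abs_le y)]
    have hHy : H y - H (a * y) = ∫ x in {x : ℝ | a * y < |x| ∧ |x| ≤ y}, x ^ 2 ∂μ := by
      rw [hHdef]
      simp only
      rw [setIntegral_shell hyz (integrableOn_sq_abs_le y), add_sub_cancel_left]
    rw [hHy, hHdef]
    simp only
    rw [← integral_const_mul, ← integral_const_mul]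
    refine add_le_add (setIntegral_mono_on (integrableOn_abs_cube_abs_le _)
      ((integrableOn_sq_abs_le _).const_mul _) (measurableSet_abs_le _) fun x hx => ?_)
      (setIntegral_mono_on ((integrableOn_abs_cube_abs_le y).mono_set fun x hx => hx.2)
      (((integrableOn_sq_abs_le y).mono_set fun x hx => hx.2).const_mul _)
      (measurableSet_shell _ _) fun x hx => ?_)
    · rw [← sq_abs x, pow_succ, mul_comm]
      exact mul_le_mul_of_nonneg_right hx (by positivity)
    · rw [← sq_abs x, pow_succ, mul_comm]
      exact mul_le_mul_of_nonneg_right hx.2 (by positivity)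
  rw [Metric.tendsto_atTop]
  intro ε hε
  obtain ⟨a, ha0, ha1, haε⟩ : ∃ a : ℝ, 0 < a ∧ a ≤ 1 ∧ a < ε / 2 :=
    ⟨min 1 (ε / 4), by positivity, min_le_left _ _,
      by have := min_le_right 1 (ε / 4); linarith⟩
  have hev : ∀ᶠ y in atTop, 0 < H y ∧ (1 - ε / 2) * H y < H (a * y) ∧ 1 ≤ y := by
    filter_upwards [hH.1, (hH.2 a ha0).eventually_const_lt
      (show (1 - ε / 2 : ℝ) < 1 by linarith), eventually_ge_atTop 1] with y h1 h2 h3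
    exact ⟨h1, (lt_div_iff₀ h1).1 h2, h3⟩
  obtain ⟨y0, hy0⟩ := eventually_atTop.1 hev
  refine ⟨y0, fun y hy => ?_⟩
  obtain ⟨h1, h2, h3⟩ := hy0 y hy
  have hy' : 0 < y := by linarith
  have hpos : 0 ≤ ∫ x in {x : ℝ | |x| ≤ y}, |x| ^ 3 ∂μ :=
    setIntegral_nonneg (measurableSet_abs_le y) fun x _ => by positivity
  have hmono : H (a * y) ≤ H y := by
    refine setIntegral_mono_set (integrableOn_sq_abs_le y)
      (Eventually.of_forall fun x => sq_nonneg x) (Eventually.of_forall fun x hx => ?_)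
    exact le_trans (show |x| ≤ a * y from hx) (by nlinarith)
  rw [Real.dist_eq, sub_zero, abs_of_nonneg (by positivity), div_lt_iff₀ (by positivity)]
  calc ∫ x in {x : ℝ | |x| ≤ y}, |x| ^ 3 ∂μ
      ≤ a * y * H (a * y) + y * (H y - H (a * y)) := hbound ha0 ha1 hy'
    _ ≤ a * y * H y + y * (ε / 2 * H y) := by
        gcongr
        linarith
    _ = (a + ε / 2) * (y * H y) := by ring
    _ < ε * (y * H y) := by
        gcongr
        linarith

lemma norm_cexp_sub_taylor_le {x s : ℝ} {y : ℝ} (hx : |x| ≤ y) :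
    ‖Complex.exp (s * x * Complex.I) - 1 - s * x * Complex.I + ((s * x) ^ 2 / 2 : ℝ)‖
      ≤ |s| ^ 3 * Real.exp (|s| * y) * |x| ^ 3 := by
  have h := Complex.norm_exp_sub_sum_le_norm_mul_exp (s * x * Complex.I) 3
  have hn : ‖(s * x * Complex.I : ℂ)‖ = |s| * |x| := by simp
  rw [hn] at h
  have he : Complex.exp (s * x * Complex.I) - 1 - s * x * Complex.I + ((s * x) ^ 2 / 2 : ℝ)
      = Complex.exp (s * x * Complex.I)
        - ∑ m ∈ Finset.range 3, (s * x * Complex.I : ℂ) ^ m / (m.factorial : ℂ) := by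
    simp only [Finset.sum_range_succ, Finset.sum_range_zero, Nat.factorial]
    push_cast
    rw [show (s * x * Complex.I : ℂ) ^ 2 = -(s * x) ^ 2 by rw [mul_pow, Complex.I_sq]; ring]
    ring
  rw [he]
  refine h.trans ?_
  have : Real.exp (|s| * |x|) ≤ Real.exp (|s| * y) := by gcongr
  calc (|s| * |x|) ^ 3 * Real.exp (|s| * |x|) ≤ (|s| * |x|) ^ 3 * Real.exp (|s| * y) := by gcongr
    _ = _ := by ring

lemma norm_cexp_sub_one_sub_le (x s : ℝ) :
    ‖Complex.exp (s * x * Complex.I) - 1 - s * x * Complex.I‖ ≤ 2 * |s| * |x| := by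
  have h : ‖Complex.exp (Complex.I * (s * x : ℝ)) - 1‖ ≤ ‖s * x‖ :=
    Real.norm_exp_I_mul_ofReal_sub_one_le
  have h' : ‖(s * x * Complex.I : ℂ)‖ = |s| * |x| := by simp
  rw [mul_comm, Complex.ofReal_mul] at h
  refine (norm_sub_le _ _).trans ?_
  rw [h']
  rw [norm_mul, Real.norm_eq_abs, Real.norm_eq_abs] at h
  linarith

/-- Mean zero allows the linear term to be subtracted for free. Then a third-order Taylor bound
serves on `|x| ≤ y` and a first-order one beyond. The factor `exp(|s| y)` is harmless: at `s = t/γ`,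
`y = γ` it equals `exp |t|`. -/
lemma norm_charFun_sub_le [IsProbabilityMeasure μ] (hint : Integrable (fun x : ℝ => x) μ) (hmean : ∫ x, x ∂μ = 0)
    (s y : ℝ) :
    ‖charFun μ s - 1 + (s ^ 2 / 2 * ∫ x in {x : ℝ | |x| ≤ y}, x ^ 2 ∂μ : ℝ)‖
      ≤ |s| ^ 3 * Real.exp (|s| * y) * (∫ x in {x : ℝ | |x| ≤ y}, |x| ^ 3 ∂μ)
        + 2 * |s| * ∫ x in {x : ℝ | y < |x|}, |x| ∂μ := by
  have hi1 : Integrable (fun x : ℝ => Complex.exp (s * x * Complex.I)) μ := by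
    refine Integrable.of_bound (by fun_prop) 1 (Eventually.of_forall fun x => ?_)
    rw [← Complex.ofReal_mul, Complex.norm_exp_ofReal_mul_I]
  have hi2 : Integrable (fun x : ℝ => (s * x * Complex.I : ℂ)) μ :=
    (hint.ofReal.const_mul (s : ℂ)).mul_const Complex.I
  have hi3 : Integrable ({x : ℝ | |x| ≤ y}.indicator fun x => ((s * x) ^ 2 / 2 : ℝ)) μ := by
    rw [integrable_indicator_iff (measurableSet_abs_le y)]
    refine ((integrableOn_sq_abs_le y).const_mul (s ^ 2 / 2)).congr (Eventually.of_forall ?_)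
    intro x
    ring
  have heq : charFun μ s - 1 + (s ^ 2 / 2 * ∫ x in {x : ℝ | |x| ≤ y}, x ^ 2 ∂μ : ℝ)
      = ∫ x, (Complex.exp (s * x * Complex.I) - 1 - s * x * Complex.I
        + (({x : ℝ | |x| ≤ y}.indicator (fun x => ((s * x) ^ 2 / 2 : ℝ)) x : ℝ) : ℂ)) ∂μ := by
    have hi6 : Integrable (fun x : ℝ => Complex.exp (s * x * Complex.I) - 1) μ :=
      hi1.sub (integrable_const 1)
    have hi7 : Integrable (fun x : ℝ => Complex.exp (s * x * Complex.I) - 1 - s * x * Complex.I)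
        μ := hi6.sub hi2
    have hi8 : Integrable (fun x : ℝ =>
        (({x : ℝ | |x| ≤ y}.indicator (fun x => ((s * x) ^ 2 / 2 : ℝ)) x : ℝ) : ℂ)) μ := hi3.ofReal
    rw [integral_add hi7 hi8, integral_sub hi6 hi2, integral_sub hi1 (integrable_const 1),
      integral_complex_ofReal, integral_indicator (measurableSet_abs_le y), charFun_apply_real]
    have h2 : ∫ x : ℝ, (s * x * Complex.I : ℂ) ∂μ = 0 := by
      rw [integral_mul_const, integral_const_mul, integral_complex_ofReal, hmean]
      simp
    rw [h2, ← integral_const_mul]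
    simp only [integral_const, probReal_univ, one_smul, sub_zero]
    congr 3
    funext x
    ring
  rw [heq]
  have hi4 : Integrable ({x : ℝ | |x| ≤ y}.indicator
      fun x => |s| ^ 3 * Real.exp (|s| * y) * |x| ^ 3) μ := by
    rw [integrable_indicator_iff (measurableSet_abs_le y)]
    exact (integrableOn_abs_cube_abs_le y).const_mul _
  have hi5 : Integrable ({x : ℝ | y < |x|}.indicator fun x => 2 * |s| * |x|) μ :=
    (hint.abs.const_mul _).indicator (measurableSet_lt_abs y)
  rw [← integral_const_mul, ← integral_const_mul, ← integral_indicator (measurableSet_abs_le y),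
    ← integral_indicator (measurableSet_lt_abs y), ← integral_add hi4 hi5]
  refine norm_integral_le_of_norm_le (hi4.add hi5) (Eventually.of_forall fun x => ?_)
  rcases le_or_gt |x| y with hx | hx
  · rw [Set.indicator_of_mem (by exact hx), Set.indicator_of_mem (by exact hx),
      Set.indicator_of_notMem (by simpa using hx), add_zero]
    exact norm_cexp_sub_taylor_le hx
  · rw [Set.indicator_of_notMem (by simpa using hx), Set.indicator_of_notMem (by simpa using hx),
      Set.indicator_of_mem (by exact hx), zero_add, Complex.ofReal_zero, add_zero]
    exact norm_cexp_sub_one_sub_le x s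

/-- A centred law with slowly varying truncated variance satisfies
`m (φ (t / γ_m) - 1) → - t² / 2` under the normalization `γ_m² ∼ m H(γ_m)`. -/
theorem tendsto_mul_charFun_sub_one [IsProbabilityMeasure μ] (hint : Integrable (fun x : ℝ => x) μ)
    (hmean : ∫ x, x ∂μ = 0)
    (hH : SlowlyVarying fun y => ∫ x in {x : ℝ | |x| ≤ y}, x ^ 2 ∂μ)
    {γ : ℕ → ℝ} (hγ_top : Tendsto γ atTop atTop)
    (hγ : (fun m => γ m ^ 2) ~[atTop]
      (fun m : ℕ => (m : ℝ) * ∫ x in {x : ℝ | |x| ≤ γ m}, x ^ 2 ∂μ)) (t : ℝ) :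
    Tendsto (fun m : ℕ => (m : ℂ) * (charFun μ (t / γ m) - 1)) atTop
      (𝓝 ((-(t ^ 2 / 2) : ℝ) : ℂ)) := by
  set H : ℝ → ℝ := fun y => ∫ x in {x : ℝ | |x| ≤ y}, x ^ 2 ∂μ with hHdef
  set r : ℕ → ℝ := fun m => m * H (γ m) / γ m ^ 2 with hr
  have hr1 : Tendsto r atTop (𝓝 1) := by
    have hne : ∀ᶠ m in atTop, γ m ^ 2 ≠ 0 := by
      filter_upwards [hγ_top.eventually_gt_atTop 0] with m hm
      positivity
    exact (Asymptotics.isEquivalent_iff_tendsto_one hne).1 hγ.symm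
  have hT := (tendsto_mul_integral_tail_div hint hH).comp hγ_top
  have hC := (tendsto_integral_abs_cube_div hH).comp hγ_top
  -- After multiplication by `m`, both error terms are `r m → 1` times a ratio already known to
  -- vanish.
  have hbd : Tendsto (fun m => |t| ^ 3 * Real.exp |t| * (r m *
      ((fun y => (∫ x in {x : ℝ | |x| ≤ y}, |x| ^ 3 ∂μ) / (y * H y)) ∘ γ) m)
      + 2 * |t| * (r m *
      ((fun y => y * (∫ x in {x : ℝ | y < |x|}, |x| ∂μ) / H y) ∘ γ) m)) atTop (𝓝 0) := by
    have := ((hr1.mul hC).const_mul (|t| ^ 3 * Real.exp |t|)).add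
      ((hr1.mul hT).const_mul (2 * |t|))
    simpa using this
  have hdiff : Tendsto (fun m : ℕ => (m : ℂ) * (charFun μ (t / γ m) - 1)
      + ((t ^ 2 / 2 * r m : ℝ) : ℂ)) atTop (𝓝 0) := by
    refine squeeze_zero_norm' ?_ hbd
    filter_upwards [hγ_top.eventually_gt_atTop 0, hγ_top.eventually hH.1] with m hm hHm
    have hHm' : 0 < H (γ m) := hHm
    have h := norm_charFun_sub_le hint hmean (t / γ m) (γ m)
    have h1 : |t / γ m| * γ m = |t| := by
      rw [abs_div, abs_of_pos hm]
      field_simp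
    rw [h1] at h
    have h2 : (m : ℂ) * (charFun μ (t / γ m) - 1) + ((t ^ 2 / 2 * r m : ℝ) : ℂ)
        = m * (charFun μ (t / γ m) - 1 + (((t / γ m) ^ 2 / 2 * H (γ m) : ℝ) : ℂ)) := by
      rw [mul_add, hr]
      push_cast
      ring
    rw [h2, norm_mul, Complex.norm_natCast]
    calc (m : ℝ) * ‖charFun μ (t / γ m) - 1 + (((t / γ m) ^ 2 / 2 * H (γ m) : ℝ) : ℂ)‖
        ≤ m * (|t / γ m| ^ 3 * Real.exp |t| * (∫ x in {x : ℝ | |x| ≤ γ m}, |x| ^ 3 ∂μ)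
          + 2 * |t / γ m| * ∫ x in {x : ℝ | γ m < |x|}, |x| ∂μ) := by
          gcongr
      _ = _ := by
        simp only [hr, Function.comp]
        rw [abs_div, abs_of_pos hm]
        field_simp
  have hlim : Tendsto (fun m => ((t ^ 2 / 2 * r m : ℝ) : ℂ)) atTop
      (𝓝 ((t ^ 2 / 2 : ℝ) : ℂ)) := by
    have h := hr1.const_mul (t ^ 2 / 2)
    rw [mul_one] at h
    exact (Complex.continuous_ofReal.tendsto _).comp h
  have := hdiff.sub hlim
  simpa using this

end AttractionToNormal

/-! ### The one-step Markov property in integrated form. -/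

section MarkovStep

variable {Ω E : Type*} [MeasurableSpace E]

/-- The σ-algebra generated by `V 0, …, V n`. -/
@[reducible]
def pastSigma (V : ℕ → Ω → E) (n : ℕ) : MeasurableSpace Ω :=
  ⨆ k ∈ Set.Iic n, MeasurableSpace.comap (V k) inferInstance

lemma measurable_pastSigma (V : ℕ → Ω → E) {k n : ℕ} (h : k ≤ n) :
    Measurable[pastSigma V n] (V k) := by
  have h1 : MeasurableSpace.comap (V k) inferInstance ≤ pastSigma V n :=
    le_iSup₂_of_le (f := fun k (_ : k ∈ Set.Iic n) =>
      MeasurableSpace.comap (V k) inferInstance) k (Set.mem_Iic.2 h) le_rfl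
  exact (comap_measurable (V k)).mono h1 le_rfl

lemma pastSigma_mono (V : ℕ → Ω → E) {m n : ℕ} (h : m ≤ n) : pastSigma V m ≤ pastSigma V n :=
  iSup₂_le fun _ hk => (measurable_pastSigma V (le_trans hk h)).comap_le

variable [MeasurableSpace Ω] {P : Measure Ω} {V : ℕ → Ω → E} {κ : Kernel E E} {μ : Measure E}

lemma IsMarkovChain.pastSigma_le (hV : IsMarkovChain P V κ μ) (n : ℕ) :
    pastSigma V n ≤ ‹MeasurableSpace Ω› :=
  iSup₂_le fun k _ => (hV.measurable k).comap_le

variable [IsProbabilityMeasure P]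

lemma IsMarkovChain.measure_inter_preimage [IsMarkovKernel κ] (hV : IsMarkovChain P V κ μ) (n : ℕ)
    {A : Set Ω} (hA : MeasurableSet[pastSigma V n] A) {B : Set E} (hB : MeasurableSet B) :
    P (A ∩ V (n + 1) ⁻¹' B) = ∫⁻ ω in A, κ (V n ω) B ∂P := by
  have hVB : MeasurableSet (V (n + 1) ⁻¹' B) := hV.measurable _ hB
  have hA' : MeasurableSet A := hV.pastSigma_le n _ hA
  have h1 := setIntegral_condExp (μ := P) (hV.pastSigma_le n)
    (f := (V (n + 1) ⁻¹' B).indicator fun _ => (1 : ℝ)) ((integrable_const 1).indicator hVB) hA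
  have hmk : P[(V (n + 1) ⁻¹' B).indicator (fun _ => (1 : ℝ)) | pastSigma V n]
      =ᵐ[P] fun ω => (κ (V n ω)).real B := hV.markov n B hB
  rw [setIntegral_congr_ae (g := fun ω => (κ (V n ω)).real B) hA'
    (hmk.mono fun ω h _ => h), setIntegral_indicator hVB] at h1
  have hm : Measurable fun ω => κ (V n ω) B := (κ.measurable_coe hB).comp (hV.measurable n)
  simp only [integral_const, smul_eq_mul, mul_one, Measure.real, Measure.restrict_apply_univ]
    at h1
  rw [integral_toReal hm.aemeasurable (Eventually.of_forall fun ω => measure_lt_top _ _)] at h1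
  have hfin : ∫⁻ ω in A, κ (V n ω) B ∂P ≠ ∞ := by
    refine ne_top_of_le_ne_top (measure_ne_top P A) ?_
    calc ∫⁻ ω in A, κ (V n ω) B ∂P ≤ ∫⁻ _ in A, 1 ∂P := lintegral_mono fun ω => prob_le_one
      _ = P A := by simp
  exact ((ENNReal.toReal_eq_toReal_iff' hfin (measure_ne_top _ _)).1 h1).symm

/-- The one-step Markov property for functions of the past and of the next state. -/
lemma IsMarkovChain.lintegral_step [IsMarkovKernel κ] (hV : IsMarkovChain P V κ μ) (n : ℕ)
    {S : Type*} [MeasurableSpace S] {X : Ω → S} (hX : Measurable[pastSigma V n] X)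
    {F : S → E → ℝ≥0∞} (hF : Measurable (Function.uncurry F)) :
    ∫⁻ ω, F (X ω) (V (n + 1) ω) ∂P = ∫⁻ ω, ∫⁻ z, F (X ω) z ∂κ (V n ω) ∂P := by
  have hX' : Measurable X := hX.mono (hV.pastSigma_le n) le_rfl
  have hXV : Measurable fun ω => (X ω, V n ω) := hX'.prodMk (hV.measurable n)
  let η : Kernel (S × E) E := κ.comap Prod.snd measurable_snd
  -- `V n` is carried along with `X` so that the next state has a conditional law depending on the
  -- pair; the identity is checked on rectangles.
  have hη : P.map (fun ω => ((X ω, V n ω), V (n + 1) ω))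
      = (P.map fun ω => (X ω, V n ω)) ⊗ₘ η := by
    have : IsProbabilityMeasure (P.map fun ω => (X ω, V n ω)) :=
      Measure.isProbabilityMeasure_map hXV.aemeasurable
    have : IsProbabilityMeasure (P.map fun ω => ((X ω, V n ω), V (n + 1) ω)) :=
      Measure.isProbabilityMeasure_map (hXV.prodMk (hV.measurable _)).aemeasurable
    refine Measure.ext_prod fun {A} {B} hA hB => ?_
    rw [Measure.compProd_apply_prod hA hB,
      Measure.map_apply (hXV.prodMk (hV.measurable _)) (hA.prod hB),
      setLIntegral_map hA (η.measurable_coe hB) hXV]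
    have hA' : MeasurableSet[pastSigma V n] ((fun ω => (X ω, V n ω)) ⁻¹' A) :=
      (hX.prodMk (measurable_pastSigma V le_rfl)) hA
    exact hV.measure_inter_preimage n hA' hB
  have h1 : ∫⁻ q, F q.1.1 q.2 ∂(P.map fun ω => ((X ω, V n ω), V (n + 1) ω))
      = ∫⁻ q, F q.1.1 q.2 ∂((P.map fun ω => (X ω, V n ω)) ⊗ₘ η) := by rw [hη]
  have hF' : Measurable fun q : (S × E) × E => F q.1.1 q.2 :=
    hF.comp ((measurable_fst.comp measurable_fst).prodMk measurable_snd)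
  rw [lintegral_map hF' (hXV.prodMk (hV.measurable _)), Measure.lintegral_compProd hF',
    lintegral_map hF'.lintegral_kernel_prod_right' hXV] at h1
  exact h1

lemma IsMarkovChain.ae_notMem [IsMarkovKernel κ] (hV : IsMarkovChain P V κ μ) {N : Set E}
    (hN : MeasurableSet N) (h0 : μ N = 0) (hκ : ∀ v ∉ N, κ v N = 0) (n : ℕ) :
    ∀ᵐ ω ∂P, V n ω ∉ N := by
  induction n with
  | zero =>
    rw [← hV.initial, Measure.map_apply (hV.measurable 0) hN] at h0
    exact measure_eq_zero_iff_ae_notMem.1 h0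
  | succ n ih =>
    have h := hV.measure_inter_preimage n MeasurableSet.univ hN
    rw [Set.univ_inter, Measure.restrict_univ, lintegral_eq_zero_of_ae_eq_zero
      (ih.mono fun ω hω => hκ _ hω)] at h
    exact measure_eq_zero_iff_ae_notMem.1 h

end MarkovStep

/-! ### The law of the partial sum given the starting point. -/

section SumKernel

/-- The law of `g(W_1) + ⋯ + g(W_n)` for the chain with transition function `κ` started at `w`. -/
def sumKernel (κ : Kernel ℝ ℝ) (g : ℝ → ℝ) : ℕ → Kernel ℝ ℝ
  | 0 => Kernel.const ℝ (Measure.dirac 0)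
  | n + 1 => (κ ⊗ₖ Kernel.prodMkLeft ℝ (sumKernel κ g n)).map fun q => g q.1 + q.2

variable {κ : Kernel ℝ ℝ} [IsMarkovKernel κ] {g : ℝ → ℝ}

lemma isMarkovKernel_sumKernel (hg : Measurable g) (n : ℕ) :
    IsMarkovKernel (sumKernel κ g n) := by
  induction n with
  | zero => unfold sumKernel; infer_instance
  | succ n ih =>
    unfold sumKernel
    exact Kernel.IsMarkovKernel.map _ (by fun_prop)

lemma lintegral_sumKernel_succ (hg : Measurable g) (n : ℕ) (w : ℝ) {F : ℝ → ℝ≥0∞}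
    (hF : Measurable F) :
    ∫⁻ s, F s ∂sumKernel κ g (n + 1) w
      = ∫⁻ z, ∫⁻ s, F (g z + s) ∂sumKernel κ g n z ∂κ w := by
  have := isMarkovKernel_sumKernel (κ := κ) hg n
  rw [sumKernel, Kernel.map_apply _ (by fun_prop), lintegral_map hF (by fun_prop),
    Kernel.lintegral_compProd _ _ _ (by fun_prop)]
  simp

lemma integral_sumKernel_succ (hg : Measurable g) (n : ℕ) (w : ℝ) {F : ℝ → ℂ}
    (hF : Measurable F) {C : ℝ} (hC : ∀ s, ‖F s‖ ≤ C) :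
    ∫ s, F s ∂sumKernel κ g (n + 1) w
      = ∫ z, ∫ s, F (g z + s) ∂sumKernel κ g n z ∂κ w := by
  have := isMarkovKernel_sumKernel (κ := κ) hg n
  rw [sumKernel, Kernel.map_apply _ (by fun_prop),
    integral_map (by fun_prop) hF.aestronglyMeasurable, integral_compProd]
  · simp
  · exact Integrable.of_bound (hF.comp (by fun_prop)).aestronglyMeasurable C (Eventually.of_forall fun _ => hC _)

lemma partialSum_succ {Ω : Type*} (g : ℝ → ℝ) (W : ℕ → Ω → ℝ) (n : ℕ) (ω : Ω) :
    partialSum g W (n + 1) ω = partialSum g W n ω + g (W (n + 1) ω) :=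
  Finset.sum_Icc_succ_top (by omega) _

lemma measurable_partialSum_pastSigma {Ω : Type*} (hg : Measurable g) (W : ℕ → Ω → ℝ) (n : ℕ) :
    Measurable[pastSigma W n] (partialSum g W n) := by
  unfold partialSum
  exact Finset.measurable_fun_sum _ fun k hk =>
    hg.comp (measurable_pastSigma W (Finset.mem_Icc.1 hk).2)

variable {Ω : Type*} [MeasurableSpace Ω] {P : Measure Ω} [IsProbabilityMeasure P]
  {W : ℕ → Ω → ℝ} {μ : Measure ℝ}

/-- Interpolation between kernel and chain: `j` steps are run along the chain and the remaining `m`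
by the kernel. One Markov step trades `(j, m + 1)` for `(j + 1, m)`. -/
lemma IsMarkovChain.lintegral_partialSum_add (hW : IsMarkovChain P W κ μ) (hg : Measurable g)
    {F : ℝ × ℝ → ℝ≥0∞} (hF : Measurable F) (m j : ℕ) :
    ∫⁻ ω, ∫⁻ s, F (W 0 ω, partialSum g W j ω + s) ∂sumKernel κ g m (W j ω) ∂P
      = ∫⁻ ω, F (W 0 ω, partialSum g W (j + m) ω) ∂P := by
  induction m generalizing j with
  | zero => simp [sumKernel, lintegral_dirac]
  | succ m ih =>
    have := isMarkovKernel_sumKernel (κ := κ) hg m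
    rw [show j + (m + 1) = j + 1 + m by ring, ← ih (j + 1)]
    have hX : Measurable[pastSigma W j] fun ω => (W 0 ω, partialSum g W j ω) :=
      (measurable_pastSigma W (Nat.zero_le j)).prodMk (measurable_partialSum_pastSigma hg W j)
    have hmeas : Measurable (Function.uncurry fun (x : ℝ × ℝ) (z : ℝ) =>
        ∫⁻ s, F (x.1, x.2 + g z + s) ∂sumKernel κ g m z) := by
      have h1 : Measurable fun q : ((ℝ × ℝ) × ℝ) × ℝ =>
          F (q.1.1.1, q.1.1.2 + g q.1.2 + q.2) := by fun_prop
      exact h1.lintegral_kernel_prod_right' (κ := Kernel.prodMkLeft (ℝ × ℝ) (sumKernel κ g m))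
    have h := hW.lintegral_step j hX hmeas
    simp only [partialSum_succ]
    rw [h]
    refine lintegral_congr fun ω => ?_
    rw [lintegral_sumKernel_succ hg m _ (by fun_prop)]
    simp only [add_assoc]

lemma IsMarkovChain.map_partialSum (hW : IsMarkovChain P W κ μ) (hg : Measurable g) (n : ℕ) :
    P.map (fun ω => (W 0 ω, partialSum g W n ω)) = P.map (W 0) ⊗ₘ sumKernel κ g n := by
  have := isMarkovKernel_sumKernel (κ := κ) hg n
  have hS : Measurable (partialSum g W n) :=
    (measurable_partialSum_pastSigma hg W n).mono (hW.pastSigma_le n) le_rfl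
  refine Measure.ext_of_lintegral _ fun F hF => ?_
  rw [lintegral_map hF ((hW.measurable 0).prodMk hS), Measure.lintegral_compProd hF,
    lintegral_map hF.lintegral_kernel_prod_right' (hW.measurable 0)]
  have h := hW.lintegral_partialSum_add hg hF n 0
  simp only [zero_add] at h
  rw [← h]
  simp [partialSum]

end SumKernel

/-! ### Geometric holding times and the law of a block. -/

section GeometricKernel

/-- The geometric law on `ℕ` with weights `p(w)^k (1 - p(w))`. -/
def geomKernel (p : ℝ → ℝ) (hp : Measurable p) : Kernel ℝ ℕ where
  toFun w := Measure.sum fun k =>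
    (ENNReal.ofReal (p w) ^ k * ENNReal.ofReal (1 - p w)) • Measure.dirac k
  measurable' := by
    refine Measure.measurable_of_measurable_coe _ fun B hB => ?_
    simp only [Measure.sum_apply _ hB, Measure.smul_apply, smul_eq_mul]
    exact Measurable.tsum fun k => by fun_prop

variable {p : ℝ → ℝ} (hp : Measurable p) (hp01 : ∀ w, p w ∈ Set.Ioo (0 : ℝ) 1)

lemma lintegral_geomKernel (w : ℝ) (F : ℕ → ℝ≥0∞) :
    ∫⁻ k, F k ∂geomKernel p hp w
      = ∑' k, ENNReal.ofReal (p w) ^ k * ENNReal.ofReal (1 - p w) * F k := by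
  change ∫⁻ k, F k ∂(Measure.sum fun k =>
    (ENNReal.ofReal (p w) ^ k * ENNReal.ofReal (1 - p w)) • Measure.dirac k) = _
  simp [lintegral_sum_measure, lintegral_smul_measure, lintegral_dirac]

include hp01 in
lemma tsum_geometric_weights (w : ℝ) :
    ∑' k, ENNReal.ofReal (p w) ^ k * ENNReal.ofReal (1 - p w) = 1 := by
  obtain ⟨h0, h1⟩ := hp01 w
  rw [ENNReal.tsum_mul_right, ENNReal.tsum_geometric, ENNReal.ofReal_sub _ h0.le,
    ENNReal.ofReal_one]
  refine ENNReal.inv_mul_cancel ?_ ?_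
  · rw [← ENNReal.ofReal_one, ← ENNReal.ofReal_sub _ h0.le]
    simpa using h1
  · exact ne_top_of_le_ne_top ENNReal.one_ne_top tsub_le_self

include hp01 in
lemma isMarkovKernel_geomKernel : IsMarkovKernel (geomKernel p hp) := by
  refine ⟨fun w => ⟨?_⟩⟩
  rw [← lintegral_one, lintegral_geomKernel]
  simpa using tsum_geometric_weights hp01 w

/-- The law of a block sum `Y = G g(w)`, where `w` has law `ν` and `G - 1` has law
`geomKernel p hp w`. -/
def blockLaw (ν : Measure ℝ) (p : ℝ → ℝ) (hp : Measurable p) (g : ℝ → ℝ) : Measure ℝ :=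
  (ν ⊗ₘ geomKernel p hp).map fun q => ((q.2 : ℝ) + 1) * g q.1

end GeometricKernel

/-! ### Identification of the law of `Y_1` from the marked chain. -/

section MarkedChain

variable {p : ℝ → ℝ} {hp : Measurable p} (hp01 : ∀ w, p w ∈ Set.Ioo (0 : ℝ) 1)
  {ν : Measure ℝ} [IsProbabilityMeasure ν]

include hp01 in
lemma ofReal_add_ofReal_one_sub (w : ℝ) :
    ENNReal.ofReal (p w) + ENNReal.ofReal (1 - p w) = 1 := by
  rw [← ENNReal.ofReal_add (hp01 w).1.le (by linarith [(hp01 w).2])]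
  simp

include hp01 in
lemma isMarkovKernel_stayOrJump : IsMarkovKernel (stayOrJump p hp ν) := by
  refine ⟨fun w => ⟨?_⟩⟩
  change (ENNReal.ofReal (p w) • Measure.dirac w + ENNReal.ofReal (1 - p w) • ν) Set.univ = 1
  simpa using ofReal_add_ofReal_one_sub hp01 w

omit [IsProbabilityMeasure ν] in
lemma lintegral_markedStayOrJump (v : ℝ × Bool) {F : ℝ × Bool → ℝ≥0∞} (hF : Measurable F) :
    ∫⁻ z, F z ∂markedStayOrJump p hp ν v
      = ENNReal.ofReal (p v.1) * F (v.1, false)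
        + ENNReal.ofReal (1 - p v.1) * ∫⁻ z, F (z, true) ∂ν := by
  change ∫⁻ z, F z ∂(ENNReal.ofReal (p v.1) • Measure.dirac (v.1, false)
    + ENNReal.ofReal (1 - p v.1) • ν.map (fun z => (z, true))) = _
  rw [lintegral_add_measure, lintegral_smul_measure, lintegral_smul_measure, lintegral_dirac,
    lintegral_map hF (by fun_prop), smul_eq_mul, smul_eq_mul]

include hp01 in
lemma isMarkovKernel_markedStayOrJump : IsMarkovKernel (markedStayOrJump p hp ν) := by
  refine ⟨fun v => ⟨?_⟩⟩
  rw [← lintegral_one, lintegral_markedStayOrJump v measurable_const]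
  simpa using ofReal_add_ofReal_one_sub hp01 v.1

variable {Ω : Type*}

/-- The steps from time `n` to time `n + k` are not jumps. -/
def noJump (V : ℕ → Ω → ℝ × Bool) (n k : ℕ) : Set Ω :=
  {ω | ∀ i, n < i → i ≤ n + k → (V i ω).2 = false}

/-- The step from time `n - 1` to time `n` has mark `b`. -/
def markAt (V : ℕ → Ω → ℝ × Bool) (n : ℕ) (b : Bool) : Set Ω := {ω | (V n ω).2 = b}

/-- The event `τ_0 = a`, `τ_1 = a + 1 + k`. -/
def blockEvent (V : ℕ → Ω → ℝ × Bool) (a k : ℕ) : Set Ω :=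
  ((noJump V 0 a ∩ markAt V (a + 1) true) ∩ noJump V (a + 1) k) ∩ markAt V (a + 1 + k + 1) true

lemma noJump_zero (V : ℕ → Ω → ℝ × Bool) (n : ℕ) : noJump V n 0 = Set.univ := by
  ext ω
  simp only [noJump, Set.mem_ofPred_eq, Set.mem_univ, iff_true]
  omega

lemma noJump_succ (V : ℕ → Ω → ℝ × Bool) (n k : ℕ) :
    noJump V n (k + 1) = noJump V n k ∩ markAt V (n + k + 1) false := by
  ext ω
  simp only [noJump, markAt, Set.mem_ofPred_eq, Set.mem_inter_iff]
  refine ⟨fun h => ⟨fun i h1 h2 => h i h1 (by omega), h _ (by omega) (by omega)⟩, ?_⟩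
  rintro ⟨h1, h2⟩ i hi hi'
  rcases Nat.lt_or_ge (n + k) i with h | h
  · obtain rfl : i = n + k + 1 := by omega
    exact h2
  · exact h1 i hi h

lemma measurableSet_markAt (V : ℕ → Ω → ℝ × Bool) {m n : ℕ} (h : m ≤ n) (b : Bool) :
    MeasurableSet[pastSigma V n] (markAt V m b) :=
  (measurable_snd.comp (measurable_pastSigma V h)) (measurableSet_singleton b)

lemma measurableSet_noJump (V : ℕ → Ω → ℝ × Bool) (m k : ℕ) :
    MeasurableSet[pastSigma V (m + k)] (noJump V m k) := by
  induction k with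
  | zero =>
    rw [noJump_zero]
    exact MeasurableSet.univ
  | succ k ih =>
    rw [noJump_succ]
    exact (pastSigma_mono V (by omega) _ ih).inter (measurableSet_markAt V le_rfl _)

lemma measurableSet_block_start (V : ℕ → Ω → ℝ × Bool) (a : ℕ) :
    MeasurableSet[pastSigma V (a + 1)] (noJump V 0 a ∩ markAt V (a + 1) true) :=
  MeasurableSet.inter (pastSigma_mono V (by omega) _ (measurableSet_noJump V 0 a))
    (measurableSet_markAt V le_rfl _)

lemma measurableSet_block_open (V : ℕ → Ω → ℝ × Bool) (a k : ℕ) :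
    MeasurableSet[pastSigma V (a + 1 + k)]
      ((noJump V 0 a ∩ markAt V (a + 1) true) ∩ noJump V (a + 1) k) :=
  MeasurableSet.inter (pastSigma_mono V (by omega) _ (measurableSet_block_start V a))
    (measurableSet_noJump V _ _)

/-- The mark at time `n + 1` records the step from `n`. On a block event the infimum is attained, so
the default `sInf ∅ = 0` plays no role. -/
lemma tau_zero_of_mem {V : ℕ → Ω → ℝ × Bool} {a k : ℕ} {ω : Ω} (h : ω ∈ blockEvent V a k) :
    tau (fun n => V n ω) 0 = a := by
  obtain ⟨⟨⟨h1, h2⟩, -⟩, -⟩ := h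
  refine IsLeast.csInf_eq ⟨h2, fun n hn => ?_⟩
  by_contra! hlt
  have := h1 (n + 1) (by omega) (by omega)
  have hn' : (V (n + 1) ω).2 = true := hn
  simp [this] at hn'

lemma tau_one_of_mem {V : ℕ → Ω → ℝ × Bool} {a k : ℕ} {ω : Ω} (h : ω ∈ blockEvent V a k) :
    tau (fun n => V n ω) 1 = a + 1 + k := by
  have h0 := tau_zero_of_mem h
  obtain ⟨⟨-, h1⟩, h2⟩ := h
  change sInf {n | tau (fun n => V n ω) 0 < n ∧ (V (n + 1) ω).2 = true} = a + 1 + k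
  rw [h0]
  refine IsLeast.csInf_eq ⟨⟨by omega, h2⟩, ?_⟩
  rintro n ⟨hn1, hn2⟩
  by_contra! hlt
  have := h1 (n + 1) (by omega) (by omega)
  simp [this] at hn2

lemma blockSum_of_mem (g : ℝ → ℝ) {V : ℕ → Ω → ℝ × Bool} {a k : ℕ} {ω : Ω}
    (h : ω ∈ blockEvent V a k) :
    blockSum g (fun n => V n ω) 1 = ((k : ℝ) + 1) * g (V (a + 1 + k) ω).1 := by
  simp only [blockSum, Nat.sub_self, tau_one_of_mem h, tau_zero_of_mem h]
  push_cast
  ring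

lemma pairwise_disjoint_blockEvent (V : ℕ → Ω → ℝ × Bool) :
    Pairwise (Function.onFun Disjoint fun q : ℕ × ℕ => blockEvent V q.1 q.2) := by
  rintro ⟨a, k⟩ ⟨a', k'⟩ hne
  refine Set.disjoint_left.2 fun ω h h' => hne ?_
  have h0 := (tau_zero_of_mem h).symm.trans (tau_zero_of_mem h')
  have h1 := (tau_one_of_mem h).symm.trans (tau_one_of_mem h')
  simp only [Prod.mk.injEq]
  omega

variable [MeasurableSpace Ω] {P : Measure Ω} {V : ℕ → Ω → ℝ × Bool}
  {μ : Measure (ℝ × Bool)}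

omit [IsProbabilityMeasure ν] in
lemma IsMarkovChain.measurableSet_blockEvent
    (hV : IsMarkovChain P V (markedStayOrJump p hp ν) μ) (a k : ℕ) :
    MeasurableSet (blockEvent V a k) :=
  (hV.pastSigma_le _ _ (measurableSet_block_open V a k)).inter
    (hV.pastSigma_le _ _ (measurableSet_markAt V le_rfl true))

variable [IsProbabilityMeasure P]

lemma IsMarkovChain.setLIntegral_step {E : Type*} [MeasurableSpace E] {V : ℕ → Ω → E}
    {κ : Kernel E E} [IsMarkovKernel κ] {μ : Measure E} (hV : IsMarkovChain P V κ μ) (n : ℕ)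
    {A : Set Ω} (hA : MeasurableSet[pastSigma V n] A) {F : E → E → ℝ≥0∞}
    (hF : Measurable (Function.uncurry F)) :
    ∫⁻ ω in A, F (V n ω) (V (n + 1) ω) ∂P = ∫⁻ ω in A, ∫⁻ z, F (V n ω) z ∂κ (V n ω) ∂P := by
  have hX : Measurable[pastSigma V n] fun ω => (A.indicator (fun _ => (1 : ℝ≥0∞)) ω, V n ω) :=
    (measurable_const.indicator hA).prodMk (measurable_pastSigma V le_rfl)
  have hG : Measurable (Function.uncurry fun (x : ℝ≥0∞ × E) (z : E) => x.1 * F x.2 z) :=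
    (measurable_fst.comp measurable_fst).mul
      (hF.comp ((measurable_snd.comp measurable_fst).prodMk measurable_snd))
  have h := hV.lintegral_step n hX hG
  have hA' : MeasurableSet A := hV.pastSigma_le n _ hA
  rw [← lintegral_indicator hA', ← lintegral_indicator hA']
  convert h using 2
  · ext ω
    by_cases hω : ω ∈ A <;> simp [hω]
  · ext ω
    by_cases hω : ω ∈ A <;> simp [hω]

/-- Fixing the mark selects one branch of the kernel, even when a jump lands on the point it left.
-/
lemma IsMarkovChain.setLIntegral_mark [IsMarkovKernel (markedStayOrJump p hp ν)]
    (hV : IsMarkovChain P V (markedStayOrJump p hp ν) μ) (n : ℕ)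
    {A : Set Ω} (hA : MeasurableSet[pastSigma V n] A) (b : Bool) {F : ℝ → ℝ → ℝ≥0∞}
    (hF : Measurable (Function.uncurry F)) :
    ∫⁻ ω in A ∩ markAt V (n + 1) b, F (V n ω).1 (V (n + 1) ω).1 ∂P
      = ∫⁻ ω in A, (if b then ENNReal.ofReal (1 - p (V n ω).1) * ∫⁻ z, F (V n ω).1 z ∂ν
          else ENNReal.ofReal (p (V n ω).1) * F (V n ω).1 (V n ω).1) ∂P := by
  have hB : MeasurableSet (markAt V (n + 1) b) :=
    hV.pastSigma_le _ _ (measurableSet_markAt V le_rfl b)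
  have hb : Measurable fun z : (ℝ × Bool) × (ℝ × Bool) =>
      ({b} : Set Bool).indicator (fun _ => (1 : ℝ≥0∞)) z.2.2 :=
    (measurable_const.indicator (measurableSet_singleton b)).comp
      (measurable_snd.comp measurable_snd)
  have hG : Measurable (Function.uncurry fun v z : ℝ × Bool =>
      ({b} : Set Bool).indicator (fun _ => (1 : ℝ≥0∞)) z.2 * F v.1 z.1) :=
    hb.mul (hF.comp ((measurable_fst.comp measurable_fst).prodMk
      (measurable_fst.comp measurable_snd)))
  have h := hV.setLIntegral_step n hA hG
  rw [Set.inter_comm, ← setLIntegral_indicator hB]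
  calc _ = ∫⁻ ω in A, ({b} : Set Bool).indicator (fun _ => (1 : ℝ≥0∞)) (V (n + 1) ω).2
        * F (V n ω).1 (V (n + 1) ω).1 ∂P := by
        refine lintegral_congr fun ω => ?_
        by_cases hω : (V (n + 1) ω).2 = b
        · rw [Set.indicator_of_mem (show ω ∈ markAt V (n + 1) b from hω)]
          simp [hω]
        · rw [Set.indicator_of_notMem (show ω ∉ markAt V (n + 1) b from hω)]
          simp [hω]
    _ = _ := by
        rw [h]
        refine lintegral_congr fun ω => ?_
        rw [lintegral_markedStayOrJump (F := fun z => ({b} : Set Bool).indicator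
          (fun _ => (1 : ℝ≥0∞)) z.2 * F (V n ω).1 z.1) _ (hG.comp measurable_prodMk_left)]
        cases b <;> simp

lemma IsMarkovChain.setLIntegral_noJump [IsMarkovKernel (markedStayOrJump p hp ν)]
    (hV : IsMarkovChain P V (markedStayOrJump p hp ν) μ) (n k : ℕ)
    {A : Set Ω} (hA : MeasurableSet[pastSigma V n] A) {F : ℝ → ℝ≥0∞} (hF : Measurable F) :
    ∫⁻ ω in A ∩ noJump V n k, F (V (n + k) ω).1 ∂P
      = ∫⁻ ω in A, ENNReal.ofReal (p (V n ω).1) ^ k * F (V n ω).1 ∂P := by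
  induction k generalizing F with
  | zero => simp [noJump_zero]
  | succ k ih =>
    have hA' : MeasurableSet[pastSigma V (n + k)] (A ∩ noJump V n k) :=
      MeasurableSet.inter (pastSigma_mono V (by omega) _ hA) (measurableSet_noJump V n k)
    have h := hV.setLIntegral_mark (n + k) hA' false (F := fun _ z => F z)
      (hF.comp measurable_snd)
    rw [noJump_succ, ← Set.inter_assoc, ← add_assoc, h]
    have h2 := ih (F := fun w => ENNReal.ofReal (p w) * F w) (by fun_prop)
    simp only [Bool.false_eq_true, if_false]
    rw [h2]
    refine lintegral_congr fun ω => ?_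
    ring

/-- The integral factorizes because the jump at time `a + 1` draws a fresh point from `ν`: the past
enters only through the first factor, the block only through the new point. The event is peeled off
from its end. -/
lemma IsMarkovChain.setLIntegral_blockEvent [IsMarkovKernel (markedStayOrJump p hp ν)]
    (hV : IsMarkovChain P V (markedStayOrJump p hp ν) μ) (a k : ℕ)
    {F : ℝ → ℝ≥0∞} (hF : Measurable F) :
    ∫⁻ ω in blockEvent V a k, F (V (a + 1 + k) ω).1 ∂P
      = (∫⁻ v, ENNReal.ofReal (p v.1) ^ a * ENNReal.ofReal (1 - p v.1) ∂μ)
        * ∫⁻ z, ENNReal.ofReal (p z) ^ k * ENNReal.ofReal (1 - p z) * F z ∂ν := by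
  have h1 := hV.setLIntegral_mark (a + 1 + k) (measurableSet_block_open V a k) true
    (F := fun w _ => F w) (hF.comp measurable_fst)
  simp only [if_true, lintegral_const, measure_univ, mul_one] at h1
  have h2 := hV.setLIntegral_noJump (a + 1) k (measurableSet_block_start V a)
    (F := fun w => ENNReal.ofReal (1 - p w) * F w) (by fun_prop)
  have h0 := measurableSet_noJump V 0 a
  rw [zero_add] at h0
  have h3 := hV.setLIntegral_mark a h0 true
    (F := fun _ z => ENNReal.ofReal (p z) ^ k * (ENNReal.ofReal (1 - p z) * F z)) (by
      have h : Measurable fun z => ENNReal.ofReal (p z) ^ k * (ENNReal.ofReal (1 - p z) * F z) := by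
        fun_prop
      exact h.comp measurable_snd)
  have h4 := hV.setLIntegral_noJump 0 a MeasurableSet.univ
    (F := fun w => ENNReal.ofReal (1 - p w)) (by fun_prop)
  simp only [if_true] at h3
  rw [lintegral_mul_const _ (by have := hV.measurable a; fun_prop)] at h3
  rw [Set.univ_inter, Measure.restrict_univ, zero_add] at h4
  rw [blockEvent, h1, h2, h3, h4, ← hV.initial, lintegral_map (by fun_prop) (hV.measurable 0)]
  simp only [mul_assoc]

include hp01 in
lemma lintegral_blockLaw {g : ℝ → ℝ} (hg : Measurable g) {F : ℝ → ℝ≥0∞} (hF : Measurable F) :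
    ∫⁻ x, F x ∂blockLaw ν p hp g = ∑' k : ℕ, ∫⁻ z, ENNReal.ofReal (p z) ^ k
      * ENNReal.ofReal (1 - p z) * F (((k : ℝ) + 1) * g z) ∂ν := by
  have := isMarkovKernel_geomKernel hp hp01
  rw [blockLaw, lintegral_map hF (by fun_prop), Measure.lintegral_compProd (by fun_prop)]
  simp only [lintegral_geomKernel]
  exact lintegral_tsum fun k => by fun_prop

include hp01 in
/-- The block sum `Y_1` of the marked chain has law `blockLaw`. -/
theorem IsMarkovChain.map_blockSum
    (hV : IsMarkovChain P V (markedStayOrJump p hp ν) μ) {g : ℝ → ℝ} (hg : Measurable g) :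
    AEMeasurable (fun ω => blockSum g (fun n => V n ω) 1) P ∧
      P.map (fun ω => blockSum g (fun n => V n ω) 1) = blockLaw ν p hp g := by
  have := isMarkovKernel_markedStayOrJump (hp := hp) (ν := ν) hp01
  have hμ : IsProbabilityMeasure μ := by
    rw [← hV.initial]
    exact Measure.isProbabilityMeasure_map (hV.measurable 0).aemeasurable
  have hE : ∀ q : ℕ × ℕ, MeasurableSet (blockEvent V q.1 q.2) :=
    fun q => hV.measurableSet_blockEvent q.1 q.2
  have hstart : ∑' a, ∫⁻ v, ENNReal.ofReal (p v.1) ^ a * ENNReal.ofReal (1 - p v.1) ∂μ = 1 := by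
    rw [← lintegral_tsum fun a => by fun_prop]
    simp [tsum_geometric_weights hp01]
  have hsum : ∀ F : ℝ → ℝ≥0∞, Measurable F →
      ∫⁻ ω in ⋃ q : ℕ × ℕ, blockEvent V q.1 q.2, F (blockSum g (fun n => V n ω) 1) ∂P
        = ∫⁻ x, F x ∂blockLaw ν p hp g := by
    intro F hF
    rw [lintegral_iUnion hE (pairwise_disjoint_blockEvent V)]
    have h1 : ∀ q : ℕ × ℕ, ∫⁻ ω in blockEvent V q.1 q.2, F (blockSum g (fun n => V n ω) 1) ∂P
        = (∫⁻ v, ENNReal.ofReal (p v.1) ^ q.1 * ENNReal.ofReal (1 - p v.1) ∂μ)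
        * ∫⁻ z, ENNReal.ofReal (p z) ^ q.2 * ENNReal.ofReal (1 - p z)
          * F (((q.2 : ℝ) + 1) * g z) ∂ν := by
      intro q
      rw [← hV.setLIntegral_blockEvent q.1 q.2 (F := fun z => F (((q.2 : ℝ) + 1) * g z))
        (by fun_prop)]
      refine setLIntegral_congr_fun (hE q) fun ω hω => ?_
      simp only [blockSum_of_mem g hω]
    simp only [h1]
    rw [ENNReal.tsum_prod (f := fun (a k : ℕ) =>
      (∫⁻ v, ENNReal.ofReal (p v.1) ^ a * ENNReal.ofReal (1 - p v.1) ∂μ)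
        * ∫⁻ z, ENNReal.ofReal (p z) ^ k * ENNReal.ofReal (1 - p z)
          * F (((k : ℝ) + 1) * g z) ∂ν)]
    simp only [ENNReal.tsum_mul_left, ENNReal.tsum_mul_right]
    rw [hstart, one_mul, lintegral_blockLaw hp01 hg hF]
  -- The masses of the block events sum to 1, so almost surely `τ_0` and `τ_1` are genuine jump
  -- times.
  have hfull : P.restrict (⋃ q : ℕ × ℕ, blockEvent V q.1 q.2) = P := by
    refine Measure.restrict_eq_self_of_ae_mem ?_
    have h1 := hsum (fun _ => 1) measurable_const
    rw [lintegral_blockLaw hp01 hg measurable_const,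
      ← lintegral_tsum fun k => by fun_prop] at h1
    simp only [mul_one, tsum_geometric_weights hp01] at h1
    simp only [lintegral_one, Measure.restrict_apply_univ, measure_univ] at h1
    exact (mem_ae_iff_prob_eq_one (MeasurableSet.iUnion hE)).2 h1
  -- On each block event the block sum is an explicit measurable function; countably many pieces are
  -- glued.
  have hmeas : AEMeasurable (fun ω => blockSum g (fun n => V n ω) 1) P := by
    rw [← hfull, aemeasurable_iUnion_iff]
    intro q
    have hVm : Measurable fun ω => ((q.2 : ℝ) + 1) * g (V (q.1 + 1 + q.2) ω).1 := by
      have := hV.measurable (q.1 + 1 + q.2)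
      fun_prop
    refine hVm.aemeasurable.congr ?_
    filter_upwards [ae_restrict_mem (hE q)] with ω hω
    exact (blockSum_of_mem g hω).symm
  refine ⟨hmeas, Measure.ext_of_lintegral _ fun F hF => ?_⟩
  rw [lintegral_map' hF.aemeasurable hmeas, ← hsum F hF, hfull]

end MarkedChain

/-! ### The renewal equation for characteristic functions. -/

section RenewalEquation

variable {p : ℝ → ℝ} (hp : Measurable p) (hp01 : ∀ w, p w ∈ Set.Ioo (0 : ℝ) 1)
  (ν : Measure ℝ) [IsProbabilityMeasure ν] (g : ℝ → ℝ)

/-- Memorylessness: either the first trial ends the wait, or the wait starts afresh with one unit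
added. -/
lemma geomKernel_eq_add_map (w : ℝ) :
    geomKernel p hp w = ENNReal.ofReal (1 - p w) • Measure.dirac 0
      + ENNReal.ofReal (p w) • (geomKernel p hp w).map Nat.succ := by
  refine Measure.ext_of_lintegral _ fun F hF => ?_
  rw [lintegral_add_measure, lintegral_smul_measure, lintegral_smul_measure, lintegral_dirac,
    lintegral_map hF measurable_from_top, lintegral_geomKernel, lintegral_geomKernel,
    tsum_eq_zero_add' ENNReal.summable, smul_eq_mul, smul_eq_mul, ← ENNReal.tsum_mul_left]
  simp only [pow_zero, one_mul, pow_succ', mul_assoc, Nat.succ_eq_add_one]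

include hp01 in
lemma integral_geomKernel_succ (w : ℝ) {F : ℕ → ℂ} {C : ℝ} (hF : ∀ k, ‖F k‖ ≤ C) :
    ∫ k, F k ∂geomKernel p hp w
      = (1 - p w : ℝ) * F 0 + p w * ∫ k, F (k + 1) ∂geomKernel p hp w := by
  have := isMarkovKernel_geomKernel hp hp01
  have hmap : IsProbabilityMeasure ((geomKernel p hp w).map Nat.succ) :=
    Measure.isProbabilityMeasure_map measurable_from_top.aemeasurable
  have hint : ∀ (m : Measure ℕ) [IsProbabilityMeasure m], Integrable F m := fun m _ =>
    Integrable.of_bound measurable_from_top.aestronglyMeasurable C (Eventually.of_forall hF)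
  conv_lhs => rw [geomKernel_eq_add_map hp w]
  rw [integral_add_measure ((hint _).smul_measure ENNReal.ofReal_ne_top)
    ((hint _).smul_measure ENNReal.ofReal_ne_top), integral_smul_measure, integral_smul_measure,
    integral_dirac, integral_map measurable_from_top.aemeasurable
    measurable_from_top.aestronglyMeasurable, ENNReal.toReal_ofReal (hp01 w).1.le,
    ENNReal.toReal_ofReal (by linarith [(hp01 w).2])]
  simp only [Complex.real_smul, Nat.succ_eq_add_one]

include hp01 in
lemma integral_stayOrJump (w : ℝ) {F : ℝ → ℂ} (hF : Measurable F) {C : ℝ} (hC : ∀ z, ‖F z‖ ≤ C) :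
    ∫ z, F z ∂stayOrJump p hp ν w = p w * F w + (1 - p w : ℝ) * ∫ z, F z ∂ν := by
  have hint : ∀ (m : Measure ℝ) [IsProbabilityMeasure m], Integrable F m := fun m _ =>
    Integrable.of_bound hF.aestronglyMeasurable C (Eventually.of_forall hC)
  change ∫ z, F z ∂(ENNReal.ofReal (p w) • Measure.dirac w + ENNReal.ofReal (1 - p w) • ν) = _
  rw [integral_add_measure ((hint _).smul_measure ENNReal.ofReal_ne_top)
    ((hint _).smul_measure ENNReal.ofReal_ne_top), integral_smul_measure, integral_smul_measure,
    integral_dirac, ENNReal.toReal_ofReal (hp01 w).1.le,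
    ENNReal.toReal_ofReal (by linarith [(hp01 w).2])]
  simp only [Complex.real_smul]

/-- The characteristic function at `s` of `g(w) + g(W_1) + ⋯ + g(W_m)` for the chain started
at `w`. -/
def startedCharFun (s : ℝ) (m : ℕ) (w : ℝ) : ℂ :=
  Complex.exp (s * g w * Complex.I) * charFun (sumKernel (stayOrJump p hp ν) g m w) s

/-- The characteristic function at `s` of the sum of `g` over the `m` steps following a jump. -/
def jumpCharFun (s : ℝ) : ℕ → ℂ
  | 0 => 1
  | m + 1 => ∫ w, startedCharFun hp ν g s m w ∂ν

variable {g}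

lemma norm_cexp_mul_I (s x : ℝ) : ‖Complex.exp (s * x * Complex.I)‖ = 1 := by
  rw [← Complex.ofReal_mul, Complex.norm_exp_ofReal_mul_I]

include hp01 in
lemma norm_startedCharFun_le (hg : Measurable g) (s : ℝ) (m : ℕ) (w : ℝ) :
    ‖startedCharFun hp ν g s m w‖ ≤ 1 := by
  have := isMarkovKernel_stayOrJump (hp := hp) (ν := ν) hp01
  have := isMarkovKernel_sumKernel (κ := stayOrJump p hp ν) hg m
  rw [startedCharFun, norm_mul, norm_cexp_mul_I, one_mul]
  exact norm_charFun_le_one s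

include hp01 in
lemma norm_jumpCharFun_le (hg : Measurable g) (s : ℝ) (m : ℕ) :
    ‖jumpCharFun hp ν g s m‖ ≤ 1 := by
  cases m with
  | zero => simp [jumpCharFun]
  | succ m =>
    refine (norm_integral_le_of_norm_le_const
      (Eventually.of_forall (norm_startedCharFun_le hp hp01 ν hg s m))).trans ?_
    simp

include hp01 in
lemma measurable_startedCharFun (hg : Measurable g) (s : ℝ) (m : ℕ) :
    Measurable (startedCharFun hp ν g s m) := by
  have := isMarkovKernel_stayOrJump (hp := hp) (ν := ν) hp01
  have := isMarkovKernel_sumKernel (κ := stayOrJump p hp ν) hg m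
  unfold startedCharFun
  simp only [charFun_apply_real]
  refine Measurable.mul (by fun_prop) ?_
  have h : StronglyMeasurable fun q : ℝ × ℝ => Complex.exp (s * q.2 * Complex.I) := by fun_prop
  exact h.integral_kernel_prod_right'.measurable

include hp01 in
lemma charFun_sumKernel_succ (hg : Measurable g) (s : ℝ) (m : ℕ) (w : ℝ) :
    charFun (sumKernel (stayOrJump p hp ν) g (m + 1) w) s
      = p w * startedCharFun hp ν g s m w + (1 - p w : ℝ) * jumpCharFun hp ν g s (m + 1) := by
  have := isMarkovKernel_stayOrJump (hp := hp) (ν := ν) hp01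
  rw [charFun_apply_real, integral_sumKernel_succ hg m w (by fun_prop)
    (fun x => (norm_cexp_mul_I s x).le)]
  have h : ∀ z, ∫ x : ℝ, Complex.exp (s * ((g z + x : ℝ) : ℂ) * Complex.I)
      ∂sumKernel (stayOrJump p hp ν) g m z = startedCharFun hp ν g s m z := by
    intro z
    rw [startedCharFun, charFun_apply_real, ← integral_const_mul]
    refine integral_congr_ae (Eventually.of_forall fun x => ?_)
    simp only
    rw [← Complex.exp_add]
    congr 1
    push_cast
    ring
  simp only [h]
  rw [integral_stayOrJump hp hp01 ν w (measurable_startedCharFun hp hp01 ν hg s m)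
    (norm_startedCharFun_le hp hp01 ν hg s m)]
  rfl

include hp01 in
/-- Conditioning on the time of the first jump. -/
lemma startedCharFun_eq_integral (hg : Measurable g) (s : ℝ) (m : ℕ) (w : ℝ) :
    startedCharFun hp ν g s m w
      = ∫ k, Complex.exp (s * ((min k m + 1 : ℕ) * g w : ℝ) * Complex.I)
          * jumpCharFun hp ν g s (m - k) ∂geomKernel p hp w := by
  have := isMarkovKernel_geomKernel hp hp01
  have hbd : ∀ m k, ‖Complex.exp (s * ((min k m + 1 : ℕ) * g w : ℝ) * Complex.I)
          * jumpCharFun hp ν g s (m - k)‖ ≤ 1 := by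
    intro m k
    rw [norm_mul, norm_cexp_mul_I, one_mul]
    exact norm_jumpCharFun_le hp hp01 ν hg s _
  induction m with
  | zero =>
    simp [startedCharFun, sumKernel, jumpCharFun]
  | succ m ih =>
    -- The first trial of the geometric law is matched with the first step of the chain: `k = 0` is
    -- a jump, and the shift `k + 1` is a stay. If no jump occurs in time, `m - k` truncates to 0,
    -- where `jumpCharFun` is 1.
    rw [integral_geomKernel_succ hp hp01 w (hbd (m + 1)), startedCharFun,
      charFun_sumKernel_succ hp hp01 ν hg, ih, mul_add, add_comm]
    congr 1
    · simp
      ring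
    · rw [mul_left_comm, ← integral_const_mul]
      congr 1
      refine integral_congr_ae (Eventually.of_forall fun k => ?_)
      simp only [Nat.add_sub_add_right, ← mul_assoc, ← Complex.exp_add,
        Nat.add_min_add_right]
      congr 2
      push_cast
      ring

include hp01 in
lemma jumpCharFun_succ (hg : Measurable g) (s : ℝ) (m : ℕ) :
    jumpCharFun hp ν g s (m + 1)
      = ∫ q, Complex.exp (s * ((min q.2 m + 1 : ℕ) * g q.1 : ℝ) * Complex.I)
          * jumpCharFun hp ν g s (m - q.2) ∂(ν ⊗ₘ geomKernel p hp) := by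
  have := isMarkovKernel_geomKernel hp hp01
  rw [Measure.integral_compProd, jumpCharFun]
  · exact integral_congr_ae (Eventually.of_forall fun w =>
      startedCharFun_eq_integral hp hp01 ν hg s m w)
  · refine Integrable.of_bound ?_ 1 (Eventually.of_forall fun q => ?_)
    · refine Measurable.aestronglyMeasurable (Measurable.mul ?_ ?_)
      · have : Measurable fun q : ℝ × ℕ => ((min q.2 m + 1 : ℕ) : ℝ) :=
          (measurable_from_top (f := fun k : ℕ => ((min k m + 1 : ℕ) : ℝ))).comp measurable_snd
        fun_prop
      · exact (measurable_from_top (f := fun k => jumpCharFun hp ν g s (m - k))).comp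
          measurable_snd
    · rw [norm_mul, norm_cexp_mul_I, one_mul]
      exact norm_jumpCharFun_le hp hp01 ν hg s _

end RenewalEquation

/-! ### Stability of renewal equations. -/

section RenewalComparison

/-- Stability of a renewal equation with summable defect. -/
lemma norm_sub_le_sum_of_renewal {S : Type*} [MeasurableSpace S] {ρ : Measure S}
    [IsProbabilityMeasure ρ] {K : S → ℕ} (hK : Measurable K) {c : ℕ → S → ℂ}
    (hc : ∀ m, Measurable (c m)) (hc1 : ∀ m q, ‖c m q‖ ≤ 1) {A L : ℕ → ℂ} (h0 : A 0 = L 0)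
    (hA : ∀ m, A (m + 1) = ∫ q, c m q * A (m - K q) ∂ρ) (j : ℕ) :
    ‖A j - L j‖ ≤ ∑ m ∈ Finset.range j, ‖∫ q, c m q * L (m - K q) ∂ρ - L (m + 1)‖ := by
  induction j using Nat.strong_induction_on with
  | _ j ih =>
    cases j with
    | zero => simp [h0]
    | succ m =>
      have hmeas : ∀ B : ℕ → ℂ, Measurable fun q => c m q * B (m - K q) := fun B =>
        (hc m).mul ((measurable_from_top (f := fun k => B (m - k))).comp hK)
      have hint : ∀ B : ℕ → ℂ, Integrable (fun q => c m q * B (m - K q)) ρ := by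
        intro B
        refine Integrable.of_bound (hmeas B).aestronglyMeasurable
          (∑ i ∈ Finset.range (m + 1), ‖B i‖) (Eventually.of_forall fun q => ?_)
        rw [norm_mul]
        calc ‖c m q‖ * ‖B (m - K q)‖ ≤ 1 * ‖B (m - K q)‖ := by gcongr; exact hc1 m q
          _ = ‖B (m - K q)‖ := one_mul _
          _ ≤ _ := Finset.single_le_sum (f := fun i => ‖B i‖) (fun i _ => norm_nonneg _)
            (Finset.mem_range.2 (by omega))
      -- The first term averages earlier errors with weights of norm at most 1, so it is bounded by
      -- the sum of defects up to `m`; the second is the new defect.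
      have hsplit : A (m + 1) - L (m + 1)
          = ∫ q, c m q * (A (m - K q) - L (m - K q)) ∂ρ
            + (∫ q, c m q * L (m - K q) ∂ρ - L (m + 1)) := by
        rw [hA]
        simp only [mul_sub]
        rw [integral_sub (hint A) (hint L)]
        ring
      rw [hsplit, Finset.sum_range_succ]
      refine (norm_add_le _ _).trans (add_le_add_left ?_ _)
      refine (norm_integral_le_of_norm_le_const (C := ∑ i ∈ Finset.range m,
        ‖∫ q, c i q * L (i - K q) ∂ρ - L (i + 1)‖) (Eventually.of_forall fun q => ?_)).trans ?_
      · rw [norm_mul]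
        calc ‖c m q‖ * ‖A (m - K q) - L (m - K q)‖ ≤ 1 * ‖A (m - K q) - L (m - K q)‖ := by
              gcongr; exact hc1 m q
          _ = ‖A (m - K q) - L (m - K q)‖ := one_mul _
          _ ≤ _ := ih (m - K q) (by omega)
          _ ≤ _ := Finset.sum_le_sum_of_subset_of_nonneg
            (Finset.range_subset_range.2 (Nat.sub_le _ _)) fun _ _ _ => norm_nonneg _
      · simp

end RenewalComparison

/-! ### Summed defects of the exponential in the renewal equation. -/

section Defect

/-- The error in comparing a block of length `k + 1`, cut at time `m + 1` and tilted by `b`, with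
its first-order expansion in `b`. -/
def renewalDefect (b u : ℝ) (k m : ℕ) : ℝ :=
  ‖Complex.exp (u * (min k m + 1 : ℕ) * Complex.I + b * (min k m + 1 : ℕ))
    - Complex.exp (u * (k + 1 : ℕ) * Complex.I) - b * (k + 1 : ℕ)‖

lemma renewalDefect_nonneg (b u : ℝ) (k m : ℕ) : 0 ≤ renewalDefect b u k m := norm_nonneg _

lemma norm_cexp_mul_nat_mul_I (u : ℝ) (k : ℕ) : ‖Complex.exp (u * k * Complex.I)‖ = 1 := by
  exact_mod_cast norm_cexp_mul_I u k

lemma renewalDefect_of_le (b u : ℝ) {k m : ℕ} (h : k ≤ m) :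
    renewalDefect b u k m = ‖Complex.exp (u * (k + 1 : ℕ) * Complex.I)
      * (Complex.exp (b * (k + 1 : ℕ)) - 1) - b * (k + 1 : ℕ)‖ := by
  rw [renewalDefect, min_eq_left h, Complex.exp_add]
  congr 1
  ring

lemma renewalDefect_le {b β : ℝ} (hb : 0 ≤ b) (u : ℝ) (k m : ℕ) (hm : b * (m + 1) ≤ β) :
    renewalDefect b u k m
      ≤ (Real.exp β + 1) * ((if m < k then 1 else 0) + b * (k + 1)) := by
  have hβ : 0 ≤ β := le_trans (by positivity) hm
  have hx : 0 ≤ b * (k + 1) := by positivity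
  have hexp : 1 ≤ Real.exp β := Real.one_le_exp hβ
  have hnx : ‖(b * (k + 1 : ℕ) : ℂ)‖ = b * (k + 1) := by
    rw [norm_mul, Complex.norm_real, Complex.norm_natCast, Real.norm_of_nonneg hb]
    push_cast
    ring
  split_ifs with h
  · have h1 : ‖Complex.exp (u * (min k m + 1 : ℕ) * Complex.I + b * (min k m + 1 : ℕ))‖
        ≤ Real.exp β := by
      rw [Complex.exp_add, norm_mul, norm_cexp_mul_nat_mul_I, one_mul, Complex.norm_exp,
        min_eq_right h.le]
      refine Real.exp_le_exp.2 (le_trans (le_of_eq ?_) hm)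
      rw [← Complex.ofReal_natCast, ← Complex.ofReal_mul, Complex.ofReal_re]
      push_cast
      ring
    refine (norm_sub_le _ _).trans ?_
    have h2 := (norm_sub_le (Complex.exp (u * (min k m + 1 : ℕ) * Complex.I
      + b * (min k m + 1 : ℕ))) (Complex.exp (u * (k + 1 : ℕ) * Complex.I)))
    rw [norm_cexp_mul_nat_mul_I] at h2
    rw [hnx]
    nlinarith
  · rw [renewalDefect_of_le b u (not_lt.1 h)]
    have hkm : b * (k + 1) ≤ β := by
      refine le_trans ?_ hm
      have : (k : ℝ) ≤ m := by exact_mod_cast not_lt.1 h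
      gcongr
    have h1 : ‖Complex.exp (b * (k + 1 : ℕ)) - 1‖ ≤ b * (k + 1) * Real.exp β := by
      have h2 := Complex.norm_exp_sub_sum_le_norm_mul_exp (b * (k + 1 : ℕ)) 1
      simp only [Finset.range_one, Finset.sum_singleton, pow_zero, Nat.factorial_zero,
        Nat.cast_one, div_one, pow_one] at h2
      rw [hnx] at h2
      refine h2.trans ?_
      gcongr
    refine (norm_sub_le _ _).trans ?_
    rw [norm_mul, norm_cexp_mul_nat_mul_I, one_mul, hnx]
    nlinarith

/-- Domination uniform in `n`: at most `k` indices have `m < k` and cost a constant each, while the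
`n` terms of order `β/n · (k + 1)` add up to `β(k + 1)`. -/
lemma sum_renewalDefect_le {β : ℝ} (hβ : 0 ≤ β) (u : ℝ) (k n : ℕ) :
    ∑ m ∈ Finset.range n, renewalDefect (β / n) u k m
      ≤ (Real.exp β + 1) * (1 + β) * (k + 1) := by
  rcases Nat.eq_zero_or_pos n with rfl | hn
  · simp only [Finset.range_zero, Finset.sum_empty]
    positivity
  have hn' : (0 : ℝ) < n := by exact_mod_cast hn
  calc ∑ m ∈ Finset.range n, renewalDefect (β / n) u k m
      ≤ ∑ m ∈ Finset.range n,
        (Real.exp β + 1) * ((if m < k then 1 else 0) + β / n * (k + 1)) := by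
        refine Finset.sum_le_sum fun m hm => renewalDefect_le (by positivity) u k m ?_
        have : (m : ℝ) + 1 ≤ n := by exact_mod_cast Finset.mem_range.1 hm
        calc β / n * (m + 1) ≤ β / n * n := by gcongr
          _ = β := by field_simp
    _ = (Real.exp β + 1) * (((Finset.range n).filter (· < k)).card + β * (k + 1)) := by
        rw [← Finset.mul_sum, Finset.sum_add_distrib, Finset.sum_const, Finset.card_range,
          Finset.sum_boole, nsmul_eq_mul]
        congr 2
        field_simp
    _ ≤ (Real.exp β + 1) * ((k + 1) + β * (k + 1)) := by
        have hcard : ((Finset.range n).filter (· < k)).card ≤ k := by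
          calc _ ≤ (Finset.range k).card := Finset.card_le_card fun i hi => by
                simp only [Finset.mem_filter, Finset.mem_range] at hi ⊢
                exact hi.2
            _ = k := Finset.card_range k
        have : (((Finset.range n).filter (· < k)).card : ℝ) ≤ k := by exact_mod_cast hcard
        gcongr
        linarith
    _ = _ := by ring

lemma tendsto_nat_mul_cexp_div_sub_one (x : ℝ) :
    Tendsto (fun n : ℕ => (n : ℂ) * (Complex.exp ((x / n : ℝ) : ℂ) - 1)) atTop (𝓝 x) := by
  rw [tendsto_iff_norm_sub_tendsto_zero]
  refine squeeze_zero' (Eventually.of_forall fun n => norm_nonneg _) ?_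
    (tendsto_const_div_atTop_nhds_zero_nat (x ^ 2))
  filter_upwards [eventually_gt_atTop 0,
    tendsto_natCast_atTop_atTop.eventually_ge_atTop |x|] with n hn hxn
  have hn' : (0 : ℝ) < n := by exact_mod_cast hn
  have hnorm : ‖((x / n : ℝ) : ℂ)‖ = |x| / n := by
    rw [Complex.norm_real, Real.norm_eq_abs, abs_div, abs_of_pos hn']
  have h := Complex.norm_exp_sub_one_sub_id_le (x := ((x / n : ℝ) : ℂ)) (by
    rw [hnorm, div_le_one hn']
    exact hxn)
  have heq : (n : ℂ) * (Complex.exp ((x / n : ℝ) : ℂ) - 1) - x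
      = n * (Complex.exp ((x / n : ℝ) : ℂ) - 1 - ((x / n : ℝ) : ℂ)) := by
    have : (n : ℂ) ≠ 0 := by exact_mod_cast hn.ne'
    push_cast
    field_simp
  rw [heq, norm_mul, Complex.norm_natCast]
  calc (n : ℝ) * _ ≤ n * ‖((x / n : ℝ) : ℂ)‖ ^ 2 := by gcongr
    _ = x ^ 2 / n := by
      rw [hnorm, div_pow, sq_abs]
      field_simp

lemma tendsto_comp_of_continuous {f : ℝ → ℂ} (hf : Continuous f) {u : ℕ → ℝ}
    (hu : Tendsto u atTop (𝓝 0)) {c : ℂ} (hc : f 0 = c) :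
    Tendsto (fun n => f (u n)) atTop (𝓝 c) :=
  hc ▸ (hf.tendsto 0).comp hu

lemma natCast_mul_norm (n : ℕ) (z : ℂ) : (n : ℝ) * ‖z‖ = ‖(n : ℂ) * z‖ := by
  rw [norm_mul, Complex.norm_natCast]

lemma continuous_renewalDefect (k m : ℕ) :
    Continuous fun q : ℝ × ℝ => renewalDefect q.1 q.2 k m := by
  unfold renewalDefect
  fun_prop

/-- For fixed `k`, the finitely many terms with `m < k` vanish one by one. The terms with `m ≥ k` do
not depend on `m`, and each is `o(1/n)` because the first-order term in `β/n` cancels. -/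
lemma tendsto_sum_renewalDefect (β : ℝ) {u : ℕ → ℝ} (hu : Tendsto u atTop (𝓝 0)) (k : ℕ) :
    Tendsto (fun n : ℕ => ∑ m ∈ Finset.range n, renewalDefect (β / n) (u n) k m) atTop
      (𝓝 0) := by
  have hb : Tendsto (fun n : ℕ => β / n) atTop (𝓝 0) := tendsto_const_div_atTop_nhds_zero_nat β
  have hbu : Tendsto (fun n : ℕ => (β / n, u n)) atTop (𝓝 (0, 0)) := hb.prodMk_nhds hu
  have h1 : Tendsto (fun n : ℕ => ∑ m ∈ Finset.range k, renewalDefect (β / n) (u n) k m) atTop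
      (𝓝 0) := by
    have h0 : ∀ m, renewalDefect 0 0 k m = 0 := fun m => by simp [renewalDefect]
    have hm : ∀ m, Tendsto (fun n : ℕ => renewalDefect (β / n) (u n) k m) atTop (𝓝 0) := by
      intro m
      have h : Tendsto (fun q : ℝ × ℝ => renewalDefect q.1 q.2 k m) (𝓝 (0, 0))
          (𝓝 (renewalDefect 0 0 k m)) := (continuous_renewalDefect k m).tendsto (0, 0)
      rw [h0 m] at h
      have h' := h.comp hbu
      simpa only [Function.comp_def] using h'
    simpa using tendsto_finsetSum (Finset.range k) fun m _ => hm m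
  have h2 : Tendsto (fun n : ℕ => n * renewalDefect (β / n) (u n) k k) atTop (𝓝 0) := by
    have hexp : Tendsto (fun n => Complex.exp (u n * (k + 1 : ℕ) * Complex.I)) atTop (𝓝 1) := by
      have hc : Continuous fun v : ℝ => Complex.exp (v * (k + 1 : ℕ) * Complex.I) := by fun_prop
      exact tendsto_comp_of_continuous hc hu (by simp)
    have h3 := ((hexp.mul (tendsto_nat_mul_cexp_div_sub_one (β * (k + 1)))).sub_const
      ((β * (k + 1) : ℝ) : ℂ)).norm
    rw [one_mul, sub_self, norm_zero] at h3
    refine h3.congr' ?_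
    filter_upwards [eventually_gt_atTop 0] with n hn
    have hn' : (n : ℂ) ≠ 0 := by exact_mod_cast hn.ne'
    rw [renewalDefect_of_le _ _ le_rfl, natCast_mul_norm]
    congr 1
    have h4 : ((β * (k + 1) / n : ℝ) : ℂ) = ((β / n : ℝ) : ℂ) * (k + 1 : ℕ) := by
      push_cast
      ring
    have h5 : ((β * (k + 1) : ℝ) : ℂ) = n * (((β / n : ℝ) : ℂ) * (k + 1 : ℕ)) := by
      push_cast
      field_simp
    rw [h4, h5]
    ring
  have h12 := h1.add h2
  rw [add_zero] at h12
  refine squeeze_zero' (Eventually.of_forall fun n =>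
    Finset.sum_nonneg fun m _ => renewalDefect_nonneg _ _ _ _) ?_ h12
  filter_upwards [eventually_ge_atTop k] with n hn
  rw [← Finset.sum_range_add_sum_Ico _ hn]
  gcongr
  rw [Finset.sum_congr rfl fun m hm => (renewalDefect_of_le (β / n) (u n)
    (Finset.mem_Ico.1 hm).1).trans (renewalDefect_of_le (β / n) (u n) le_rfl).symm,
    Finset.sum_const, Nat.card_Ico, nsmul_eq_mul]
  gcongr
  · exact renewalDefect_nonneg _ _ _ _
  · exact Nat.sub_le _ _

end Defect

/-! ### Comparison of the characteristic functions with exponentials. -/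

section Comparison

variable {p : ℝ → ℝ} (hp : Measurable p) (hp01 : ∀ w, p w ∈ Set.Ioo (0 : ℝ) 1)
  (ν : Measure ℝ) [IsProbabilityMeasure ν] {g : ℝ → ℝ}

lemma measurable_comp_snd {S T : Type*} [MeasurableSpace S] [MeasurableSpace T] (f : ℕ → T) :
    Measurable fun q : S × ℕ => f q.2 :=
  (measurable_from_top (f := f)).comp measurable_snd

lemma measurable_sum_renewalDefect (hg : Measurable g) (b s : ℝ) (n : ℕ) :
    Measurable fun q : ℝ × ℕ => ∑ m ∈ Finset.range n, renewalDefect b (s * g q.1) q.2 m := by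
  refine Finset.measurable_fun_sum _ fun m _ => ?_
  unfold renewalDefect
  have h1 : Measurable fun q : ℝ × ℕ => ((min q.2 m + 1 : ℕ) : ℂ) :=
    measurable_comp_snd fun k => ((min k m + 1 : ℕ) : ℂ)
  have h2 : Measurable fun q : ℝ × ℕ => ((q.2 + 1 : ℕ) : ℂ) :=
    measurable_comp_snd fun k => ((k + 1 : ℕ) : ℂ)
  fun_prop

omit [IsProbabilityMeasure ν] in
include hp01 in
lemma tendsto_integral_sum_renewalDefect (hg : Measurable g)
    (hG : Integrable (fun q : ℝ × ℕ => (q.2 : ℝ) + 1) (ν ⊗ₘ geomKernel p hp)) {β : ℝ} (hβ : 0 ≤ β)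
    {s : ℕ → ℝ} (hs : Tendsto s atTop (𝓝 0)) :
    Tendsto (fun n : ℕ => ∫ q, ∑ m ∈ Finset.range n, renewalDefect (β / n) (s n * g q.1) q.2 m
      ∂(ν ⊗ₘ geomKernel p hp)) atTop (𝓝 0) := by
  have := isMarkovKernel_geomKernel hp hp01
  rw [← integral_zero (ℝ × ℕ) ℝ (μ := ν ⊗ₘ geomKernel p hp)]
  refine tendsto_integral_of_dominated_convergence
    (fun q => (Real.exp β + 1) * (1 + β) * ((q.2 : ℝ) + 1))
    (fun n => (measurable_sum_renewalDefect hg _ _ n).aestronglyMeasurable) (hG.const_mul _)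
    (fun n => Eventually.of_forall fun q => ?_) (Eventually.of_forall fun q => ?_)
  · rw [Real.norm_of_nonneg (Finset.sum_nonneg fun m _ => renewalDefect_nonneg _ _ _ _)]
    exact sum_renewalDefect_le hβ _ _ _
  · exact tendsto_sum_renewalDefect β (by simpa using hs.mul_const (g q.1)) q.2

include hp01 in
lemma norm_integral_renewal_sub_le (hg : Measurable g)
    (hG : Integrable (fun q : ℝ × ℕ => (q.2 : ℝ) + 1) (ν ⊗ₘ geomKernel p hp)) {b : ℝ} (hb : 0 ≤ b)
    (s : ℝ) (m : ℕ) :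
    ‖∫ q, Complex.exp (s * ((min q.2 m + 1 : ℕ) * g q.1 : ℝ) * Complex.I)
          * Complex.exp (-(b * (m - q.2 : ℕ))) ∂(ν ⊗ₘ geomKernel p hp)
        - Complex.exp (-(b * (m + 1 : ℕ)))‖
      ≤ ‖charFun (blockLaw ν p hp g) s - 1
          + (b * ∫ q, ((q.2 : ℝ) + 1) ∂(ν ⊗ₘ geomKernel p hp) : ℝ)‖
        + ∫ q, renewalDefect b (s * g q.1) q.2 m ∂(ν ⊗ₘ geomKernel p hp) := by
  have := isMarkovKernel_geomKernel hp hp01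
  set ρ := ν ⊗ₘ geomKernel p hp with hρ
  have hN : ∀ f : ℕ → ℂ, Measurable fun q : ℝ × ℕ => f q.2 := fun f => measurable_comp_snd f
  have hmin := hN fun k => ((min k m + 1 : ℕ) : ℂ)
  have hk := hN fun k => ((k + 1 : ℕ) : ℂ)
  set E : ℝ × ℕ → ℂ := fun q => Complex.exp (((s * g q.1 : ℝ) : ℂ) * (min q.2 m + 1 : ℕ)
    * Complex.I + b * (min q.2 m + 1 : ℕ)) with hE
  set Z : ℝ × ℕ → ℂ := fun q =>
    Complex.exp (((s * g q.1 : ℝ) : ℂ) * (q.2 + 1 : ℕ) * Complex.I) with hZ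
  have hEm : Measurable E := by rw [hE]; fun_prop
  have hZm : Measurable Z := by rw [hZ]; fun_prop
  have hEi : Integrable E ρ := by
    refine Integrable.of_bound hEm.aestronglyMeasurable (Real.exp (b * (m + 1)))
      (Eventually.of_forall fun q => ?_)
    rw [hE]
    simp only
    rw [Complex.exp_add, norm_mul, norm_cexp_mul_nat_mul_I, one_mul, Complex.norm_exp]
    refine Real.exp_le_exp.2 ?_
    rw [← Complex.ofReal_natCast, ← Complex.ofReal_mul, Complex.ofReal_re]
    push_cast
    gcongr
    exact_mod_cast min_le_right _ _
  have hZi : Integrable Z ρ := by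
    refine Integrable.of_bound hZm.aestronglyMeasurable 1 (Eventually.of_forall fun q => ?_)
    exact (norm_cexp_mul_nat_mul_I _ _).le
  have hGi : Integrable (fun q : ℝ × ℕ => (b * (q.2 + 1 : ℕ) : ℂ)) ρ := by
    have h := (hG.const_mul b).ofReal (𝕜 := ℂ)
    refine h.congr (Eventually.of_forall fun q => ?_)
    simp
  have hGint : ∫ q, (b * (q.2 + 1 : ℕ) : ℂ) ∂ρ = ((b * ∫ q, ((q.2 : ℝ) + 1) ∂ρ : ℝ) : ℂ) := by
    rw [← integral_const_mul, ← integral_complex_ofReal]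
    refine integral_congr_ae (Eventually.of_forall fun q => ?_)
    simp
  have hZint : ∫ q, Z q ∂ρ = charFun (blockLaw ν p hp g) s := by
    have hY : Measurable fun q : ℝ × ℕ => ((q.2 : ℝ) + 1) * g q.1 := by
      have := measurable_comp_snd (S := ℝ) fun k : ℕ => (k : ℝ)
      fun_prop
    rw [charFun_apply_real, blockLaw, integral_map hY.aemeasurable (by fun_prop)]
    refine integral_congr_ae (Eventually.of_forall fun q => ?_)
    simp only [hZ]
    congr 1
    push_cast
    ring
  -- Since `(m - k) + (min k m + 1) = m + 1` with truncated subtraction, pulling out `exp(-b(m +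
  -- 1))` leaves a block tilted by `exp(b · length)`.
  have hfactor : ∀ q : ℝ × ℕ, Complex.exp (s * ((min q.2 m + 1 : ℕ) * g q.1 : ℝ) * Complex.I)
      * Complex.exp (-(b * (m - q.2 : ℕ))) = Complex.exp (-(b * (m + 1 : ℕ))) * E q := by
    intro q
    simp only [hE]
    rw [← Complex.exp_add, ← Complex.exp_add]
    congr 1
    have h : ((m - q.2 : ℕ) : ℂ) = (m + 1 : ℕ) - (min q.2 m + 1 : ℕ) := by
      rw [← Nat.cast_sub (by omega)]
      congr 1
      omega
    rw [h, Complex.ofReal_mul, Complex.ofReal_mul, Complex.ofReal_natCast]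
    generalize min q.2 m + 1 = N
    ring
  -- The uncut, untilted block `Z` and the linear term are added and subtracted; what is left over
  -- is the integrand whose norm is `renewalDefect`.
  have hEint : ∫ q, E q ∂ρ - 1 = (charFun (blockLaw ν p hp g) s - 1
      + (b * ∫ q, ((q.2 : ℝ) + 1) ∂ρ : ℝ)) + ∫ q, (E q - Z q - b * (q.2 + 1 : ℕ)) ∂ρ := by
    have hEZ : Integrable (fun q => E q - Z q) ρ := hEi.sub hZi
    rw [integral_sub hEZ hGi, integral_sub hEi hZi, hGint, hZint]
    ring
  simp only [hfactor]
  rw [integral_const_mul, ← mul_sub_one, norm_mul, hEint]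
  have hone : ‖Complex.exp (-(b * (m + 1 : ℕ)))‖ ≤ 1 := by
    rw [Complex.norm_exp, ← Complex.ofReal_natCast, ← Complex.ofReal_mul, Complex.neg_re,
      Complex.ofReal_re, Real.exp_le_one_iff, neg_nonpos]
    positivity
  refine (mul_le_of_le_one_left (norm_nonneg _) hone).trans ((norm_add_le _ _).trans ?_)
  gcongr
  exact norm_integral_le_integral_norm _

include hp01 in
/-- The characteristic functions of the sums after a jump are uniformly close to exponentials. -/
lemma exists_bound_jumpCharFun_sub (hg : Measurable g)
    (hG : Integrable (fun q : ℝ × ℕ => (q.2 : ℝ) + 1) (ν ⊗ₘ geomKernel p hp)) {β : ℝ} (hβ : 0 ≤ β)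
    {s : ℕ → ℝ} (hs : Tendsto s atTop (𝓝 0))
    (hclt : Tendsto (fun n : ℕ => (n : ℂ) * (charFun (blockLaw ν p hp g) (s n) - 1)) atTop
      (𝓝 ((-(β * ∫ q, ((q.2 : ℝ) + 1) ∂(ν ⊗ₘ geomKernel p hp)) : ℝ) : ℂ))) :
    ∃ R : ℕ → ℝ, Tendsto R atTop (𝓝 0) ∧ ∀ n j, 0 < n → j ≤ n →
      ‖jumpCharFun hp ν g (s n) j - Complex.exp (-((β / n : ℝ) * j))‖ ≤ R n := by
  have := isMarkovKernel_geomKernel hp hp01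
  set ρ := ν ⊗ₘ geomKernel p hp with hρ
  set θ := ∫ q, ((q.2 : ℝ) + 1) ∂ρ with hθ
  -- The bound is `n` times the first-order discrepancy of a block plus the summed defects;
  -- extending the sum from `j` to `n` makes it independent of `j`.
  refine ⟨fun n => ‖(n : ℂ) * (charFun (blockLaw ν p hp g) (s n) - 1) + (β * θ : ℝ)‖
    + ∫ q, ∑ m ∈ Finset.range n, renewalDefect (β / n) (s n * g q.1) q.2 m ∂ρ, ?_, ?_⟩
  · have h1 := (hclt.add_const ((β * θ : ℝ) : ℂ)).norm
    rw [Complex.ofReal_neg, neg_add_cancel, norm_zero] at h1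
    simpa using h1.add (tendsto_integral_sum_renewalDefect hp hp01 ν hg hG hβ hs)
  · intro n j hn hj
    have hn' : (n : ℂ) ≠ 0 := by exact_mod_cast hn.ne'
    have hc : ∀ m, Measurable fun q : ℝ × ℕ =>
        Complex.exp (s n * ((min q.2 m + 1 : ℕ) * g q.1 : ℝ) * Complex.I) := by
      intro m
      have := measurable_comp_snd (S := ℝ) fun k : ℕ => ((min k m + 1 : ℕ) : ℝ)
      fun_prop
    have h := norm_sub_le_sum_of_renewal (ρ := ρ) measurable_snd hc
      (fun m q => (norm_cexp_mul_I _ _).le) (A := jumpCharFun hp ν g (s n))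
      (L := fun i => Complex.exp (-((β / n : ℝ) * i))) (by simp [jumpCharFun])
      (jumpCharFun_succ hp hp01 ν hg (s n)) j
    refine h.trans ((Finset.sum_le_sum_of_subset_of_nonneg (Finset.range_subset_range.2 hj)
      fun _ _ _ => norm_nonneg _).trans ((Finset.sum_le_sum fun m _ =>
      norm_integral_renewal_sub_le hp hp01 ν hg hG (b := β / n) (by positivity) (s n) m).trans ?_))
    beta_reduce
    rw [Finset.sum_add_distrib, Finset.sum_const, Finset.card_range, nsmul_eq_mul,
      integral_finsetSum]
    · gcongr
      rw [natCast_mul_norm]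
      refine le_of_eq (congrArg _ ?_)
      push_cast
      field_simp
      rw [hθ]
    · intro m hm
      have hmeas : Measurable fun q : ℝ × ℕ => renewalDefect (β / n) (s n * g q.1) q.2 m := by
        have h1 := measurable_comp_snd (S := ℝ) fun k : ℕ => ((min k m + 1 : ℕ) : ℂ)
        have h2 := measurable_comp_snd (S := ℝ) fun k : ℕ => ((k + 1 : ℕ) : ℂ)
        unfold renewalDefect
        fun_prop
      refine (hG.const_mul ((Real.exp β + 1) * (1 + β))).mono' hmeas.aestronglyMeasurable
        (Eventually.of_forall fun q => ?_)
      rw [Real.norm_of_nonneg (renewalDefect_nonneg _ _ _ _)]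
      exact (Finset.single_le_sum (f := fun m => renewalDefect (β / n) (s n * g q.1) q.2 m)
        (fun _ _ => renewalDefect_nonneg _ _ _ _) hm).trans (sum_renewalDefect_le hβ _ _ _)

include hp01 in
lemma tendsto_charFun_sumKernel (hg : Measurable g)
    (hG : Integrable (fun q : ℝ × ℕ => (q.2 : ℝ) + 1) (ν ⊗ₘ geomKernel p hp)) {β : ℝ} (hβ : 0 ≤ β)
    {s : ℕ → ℝ} (hs : Tendsto s atTop (𝓝 0))
    (hclt : Tendsto (fun n : ℕ => (n : ℂ) * (charFun (blockLaw ν p hp g) (s n) - 1)) atTop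
      (𝓝 ((-(β * ∫ q, ((q.2 : ℝ) + 1) ∂(ν ⊗ₘ geomKernel p hp)) : ℝ) : ℂ))) (w : ℝ) :
    Tendsto (fun n => charFun (sumKernel (stayOrJump p hp ν) g n w) (s n)) atTop
      (𝓝 (Complex.exp (-β))) := by
  have := isMarkovKernel_geomKernel hp hp01
  obtain ⟨R, hR, hbound⟩ := exists_bound_jumpCharFun_sub hp hp01 ν hg hG hβ hs hclt
  have hjump : ∀ k : ℕ, Tendsto (fun n => jumpCharFun hp ν g (s n) (n - k)) atTop
      (𝓝 (Complex.exp (-β))) := by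
    intro k
    have h1 : Tendsto (fun n : ℕ => Complex.exp (-((β / n : ℝ) * (n - k : ℕ)))) atTop
        (𝓝 (Complex.exp (-β))) := by
      have h2 : Tendsto (fun n : ℕ => Complex.exp (-((β : ℂ) - ((β / n : ℝ) : ℂ) * k))) atTop
          (𝓝 (Complex.exp (-β))) := by
        have hc : Continuous fun b : ℝ => Complex.exp (-((β : ℂ) - (b : ℂ) * k)) := by fun_prop
        exact tendsto_comp_of_continuous hc (tendsto_const_div_atTop_nhds_zero_nat β) (by simp)
      refine h2.congr' ?_
      filter_upwards [eventually_gt_atTop 0, eventually_ge_atTop k] with n hn hk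
      have hn' : (n : ℂ) ≠ 0 := by exact_mod_cast hn.ne'
      congr 2
      push_cast [Nat.cast_sub hk]
      field_simp
    have h3 : Tendsto (fun n => jumpCharFun hp ν g (s n) (n - k)
        - Complex.exp (-((β / n : ℝ) * (n - k : ℕ)))) atTop (𝓝 0) := by
      refine squeeze_zero_norm' ?_ hR
      filter_upwards [eventually_gt_atTop 0] with n hn
      exact hbound n (n - k) hn (Nat.sub_le _ _)
    simpa using h3.add h1
  have hstart : Tendsto (fun n => startedCharFun hp ν g (s n) n w) atTop
      (𝓝 (Complex.exp (-β))) := by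
    have hlim : ∫ _k, Complex.exp (-β) ∂geomKernel p hp w = Complex.exp (-β) := by simp
    rw [← hlim]
    simp only [startedCharFun_eq_integral hp hp01 ν hg]
    refine tendsto_integral_of_dominated_convergence (fun _ => 1)
      (fun n => measurable_from_top.aestronglyMeasurable) (integrable_const 1)
      (fun n => Eventually.of_forall fun k => ?_) (Eventually.of_forall fun k => ?_)
    · rw [norm_mul, norm_cexp_mul_I, one_mul]
      exact norm_jumpCharFun_le hp hp01 ν hg _ _
    · rw [← one_mul (Complex.exp (-β))]
      refine Tendsto.mul ?_ (hjump k)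
      have hc : Continuous fun b : ℝ =>
          Complex.exp (b * ((k + 1 : ℕ) * g w : ℝ) * Complex.I) := by fun_prop
      have h1 : Tendsto (fun n => Complex.exp (s n * ((k + 1 : ℕ) * g w : ℝ) * Complex.I))
          atTop (𝓝 1) := by
        exact tendsto_comp_of_continuous hc hs (by simp)
      refine h1.congr' ?_
      filter_upwards [eventually_ge_atTop k] with n hn
      rw [min_eq_left hn]
  -- `startedCharFun` counts `g` at the starting point and the partial sum does not; the correcting
  -- factor tends to 1.
  have hexp : Tendsto (fun n => Complex.exp (-(s n * g w * Complex.I))) atTop (𝓝 1) := by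
    have hc : Continuous fun b : ℝ => Complex.exp (-(b * g w * Complex.I)) := by fun_prop
    exact tendsto_comp_of_continuous hc hs (by simp)
  have h := hexp.mul hstart
  rw [one_mul] at h
  refine h.congr fun n => ?_
  rw [startedCharFun, ← mul_assoc, ← Complex.exp_add, neg_add_cancel, Complex.exp_zero, one_mul]

end Comparison

/-! ### Moments of a block and the stationary law. -/

section Moments

variable {p : ℝ → ℝ} (hp : Measurable p) (hp01 : ∀ w, p w ∈ Set.Ioo (0 : ℝ) 1)
  (ν : Measure ℝ) [IsProbabilityMeasure ν] {g : ℝ → ℝ}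

lemma hasSum_geometric_mean {r : ℝ} (h0 : 0 < r) (h1 : r < 1) :
    HasSum (fun k : ℕ => r ^ k * (1 - r) * ((k : ℝ) + 1)) (1 - r)⁻¹ := by
  have hr : ‖r‖ < 1 := by rwa [Real.norm_of_nonneg h0.le]
  have h := ((hasSum_coe_mul_geometric_of_norm_lt_one hr).add
    (hasSum_geometric_of_norm_lt_one hr)).mul_right (1 - r)
  have hne : 1 - r ≠ 0 := by linarith
  have h1 : (r / (1 - r) ^ 2 + (1 - r)⁻¹) * (1 - r) = (1 - r)⁻¹ := by
    field_simp
    ring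
  rw [h1] at h
  refine h.congr_fun fun k => ?_
  ring

include hp01 in
lemma lintegral_succ_geomKernel (w : ℝ) :
    ∫⁻ k : ℕ, ENNReal.ofReal ((k : ℝ) + 1) ∂geomKernel p hp w = ENNReal.ofReal (1 - p w)⁻¹ := by
  obtain ⟨h0, h1⟩ := hp01 w
  have hsum := hasSum_geometric_mean h0 h1
  rw [lintegral_geomKernel, ← hsum.tsum_eq, ENNReal.ofReal_tsum_of_nonneg _ hsum.summable]
  · refine tsum_congr fun k => ?_
    rw [ENNReal.ofReal_mul (mul_nonneg (pow_nonneg h0.le _) (by linarith)),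
      ENNReal.ofReal_mul (pow_nonneg h0.le _), ENNReal.ofReal_pow h0.le]
  · intro k
    exact mul_nonneg (mul_nonneg (pow_nonneg h0.le _) (by linarith)) (by positivity)

include hp01 in
lemma integrable_succ_geomKernel (w : ℝ) :
    Integrable (fun k : ℕ => (k : ℝ) + 1) (geomKernel p hp w) := by
  refine ⟨measurable_from_top.aestronglyMeasurable, ?_⟩
  rw [hasFiniteIntegral_iff_ofReal (Eventually.of_forall fun k => by positivity),
    lintegral_succ_geomKernel hp hp01]
  exact ENNReal.ofReal_lt_top

include hp01 in
lemma integral_succ_geomKernel (w : ℝ) :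
    ∫ k : ℕ, ((k : ℝ) + 1) ∂geomKernel p hp w = (1 - p w)⁻¹ := by
  rw [integral_eq_lintegral_of_nonneg_ae (Eventually.of_forall fun k => by positivity)
    measurable_from_top.aestronglyMeasurable, lintegral_succ_geomKernel hp hp01,
    ENNReal.toReal_ofReal (inv_nonneg.2 (by linarith [(hp01 w).2]))]

include hp01 in
lemma integrable_block_sum (hg : Measurable g) (hgi : Integrable (fun w => g w * (1 - p w)⁻¹) ν) :
    Integrable (fun q : ℝ × ℕ => ((q.2 : ℝ) + 1) * g q.1) (ν ⊗ₘ geomKernel p hp) := by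
  have := isMarkovKernel_geomKernel hp hp01
  have hm := measurable_comp_snd (S := ℝ) fun k : ℕ => (k : ℝ)
  have hY : Measurable fun q : ℝ × ℕ => ((q.2 : ℝ) + 1) * g q.1 := by fun_prop
  rw [Measure.integrable_compProd_iff hY.aestronglyMeasurable]
  have hnorm : ∀ w, ∫ k : ℕ, ‖((k : ℝ) + 1) * g w‖ ∂geomKernel p hp w = ‖g w * (1 - p w)⁻¹‖ := by
    intro w
    have hk : ∀ k : ℕ, ‖((k : ℝ) + 1) * g w‖ = ((k : ℝ) + 1) * ‖g w‖ := fun k => by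
      rw [norm_mul, Real.norm_of_nonneg (by positivity)]
    simp only [hk]
    rw [integral_mul_const, integral_succ_geomKernel hp hp01, norm_mul,
      Real.norm_of_nonneg (inv_nonneg.2 (by linarith [(hp01 w).2])), mul_comm]
  have hint : ∀ w, Integrable (fun k : ℕ => ((k : ℝ) + 1) * g w) (geomKernel p hp w) :=
    fun w => (integrable_succ_geomKernel hp hp01 w).mul_const _
  refine ⟨Eventually.of_forall hint, ?_⟩
  simp only [hnorm]
  exact hgi.norm

include hp01 in
lemma integral_block_sum (hg : Measurable g) (hgi : Integrable (fun w => g w * (1 - p w)⁻¹) ν) :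
    ∫ q, ((q.2 : ℝ) + 1) * g q.1 ∂(ν ⊗ₘ geomKernel p hp) = ∫ w, g w * (1 - p w)⁻¹ ∂ν := by
  have := isMarkovKernel_geomKernel hp hp01
  rw [Measure.integral_compProd (integrable_block_sum hp hp01 ν hg hgi)]
  refine integral_congr_ae (Eventually.of_forall fun w => ?_)
  simp only
  rw [integral_mul_const, integral_succ_geomKernel hp hp01, mul_comm]

include hp01 in
lemma isProbabilityMeasure_blockLaw (hg : Measurable g) :
    IsProbabilityMeasure (blockLaw ν p hp g) := by
  have := isMarkovKernel_geomKernel hp hp01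
  have hm := measurable_comp_snd (S := ℝ) fun k : ℕ => (k : ℝ)
  exact Measure.isProbabilityMeasure_map (by fun_prop)

include hp01 in
lemma one_le_theta (hθ : Integrable (fun w => (1 - p w)⁻¹) ν) : 1 ≤ theta p ν := by
  calc (1 : ℝ) = ∫ _, (1 : ℝ) ∂ν := by simp
    _ ≤ theta p ν := integral_mono (integrable_const 1) hθ fun w =>
      (one_le_inv₀ (by linarith [(hp01 w).2])).2 (by linarith [(hp01 w).1])

include hp in
lemma measurable_stationary_density (θ : ℝ) :
    Measurable fun w => ENNReal.ofReal (θ * (1 - p w))⁻¹ := by fun_prop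

include hp hp01 in
-- Jumps land according to `ν`, whereas `g` is only determined up to a null set of the stationary
-- law.
lemma absolutelyContinuous_stationaryLaw (hθ : Integrable (fun w => (1 - p w)⁻¹) ν) :
    ν ≪ stationaryLaw p ν := by
  have h1 := one_le_theta hp01 ν hθ
  refine withDensity_absolutelyContinuous'
    (measurable_stationary_density hp (theta p ν)).aemeasurable
    (Eventually.of_forall fun w => ?_)
  have : 0 < (theta p ν * (1 - p w))⁻¹ :=
    inv_pos.2 (mul_pos (by linarith) (by linarith [(hp01 w).2]))
  exact (ENNReal.ofReal_pos.2 this).ne'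

omit [IsProbabilityMeasure ν] in
lemma isFiniteMeasure_stationaryLaw (hθ : Integrable (fun w => (1 - p w)⁻¹) ν) :
    IsFiniteMeasure (stationaryLaw p ν) := by
  refine isFiniteMeasure_withDensity_ofReal ?_
  simp only [mul_inv]
  exact (hθ.const_mul _).2

include hp hp01 in
-- The mean block length from `w` is `(1 - p w)⁻¹`, which is `θ` times the stationary density; hence
-- `∫ g dπ = 0` makes the blocks centred.
lemma integrable_and_integral_of_stationary (hθ : Integrable (fun w => (1 - p w)⁻¹) ν)
    (hgi : Integrable g (stationaryLaw p ν)) :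
    Integrable (fun w => g w * (1 - p w)⁻¹) ν ∧
      ∫ w, g w * (1 - p w)⁻¹ ∂ν = theta p ν * ∫ w, g w ∂stationaryLaw p ν := by
  have h1 := one_le_theta hp01 ν hθ
  have hd := measurable_stationary_density hp (theta p ν)
  have hfin : ∀ᵐ w ∂ν, ENNReal.ofReal (theta p ν * (1 - p w))⁻¹ < ∞ :=
    Eventually.of_forall fun w => ENNReal.ofReal_lt_top
  have heq : ∀ w, g w * (1 - p w)⁻¹
      = theta p ν * ((ENNReal.ofReal (theta p ν * (1 - p w))⁻¹).toReal • g w) := by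
    intro w
    have h2 : 0 < 1 - p w := by linarith [(hp01 w).2]
    rw [ENNReal.toReal_ofReal (by positivity), smul_eq_mul]
    field_simp
  rw [stationaryLaw, integrable_withDensity_iff_integrable_smul' hd hfin] at hgi
  simp only [heq]
  refine ⟨hgi.const_mul _, ?_⟩
  rw [integral_const_mul, stationaryLaw, integral_withDensity_eq_integral_toReal_smul hd hfin]

end Moments

/-! ### From almost sure to in-probability convergence of random laws. -/

section ConvergenceInProbability

variable {Ω : Type*} [MeasurableSpace Ω] {P : Measure Ω} [IsProbabilityMeasure P]

/-- Almost sure weak convergence of conditional laws implies convergence in probability. -/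
lemma condLawTendstoInProb_of_ae {X : Ω → ℝ} (hX : Measurable X) {Z : ℕ → Ω → ℝ}
    {G : ProbabilityMeasure ℝ}
    (h : ∀ᵐ ω ∂P, Tendsto (β := ProbabilityMeasure ℝ)
      (fun n => ⟨condDistrib (Z n) X P (X ω), inferInstance⟩) atTop (𝓝 G)) : CondLawTendstoInProb P X Z G := by
  set c : ℕ → Ω → ProbabilityMeasure ℝ := fun n ω => ⟨condDistrib (Z n) X P (X ω), inferInstance⟩
    with hc
  -- Convergence in probability to `G` is convergence of this filter to `G`, so it can be tested on
  -- one bounded continuous function at a time, for real random variables.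
  let L : Filter (ProbabilityMeasure ℝ) :=
    { sets := {U | Tendsto (fun n => P {ω | c n ω ∉ U}) atTop (𝓝 0)}
      univ_sets := by simp
      sets_of_superset := fun {U U'} hU hUU' =>
        tendsto_of_tendsto_of_tendsto_of_le_of_le tendsto_const_nhds hU (fun _ => zero_le)
          fun n => measure_mono fun ω hω hω' => hω (hUU' hω')
      inter_sets := fun {U U'} hU hU' => by
        have hadd := Tendsto.add (f := fun n => P {ω | c n ω ∉ U})
          (g := fun n => P {ω | c n ω ∉ U'}) hU hU'
        rw [add_zero] at hadd
        refine tendsto_of_tendsto_of_tendsto_of_le_of_le tendsto_const_nhds hadd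
          (fun _ => zero_le) fun n => (measure_mono fun ω hω => ?_).trans (measure_union_le _ _)
        by_contra hcon
        simp only [Set.mem_union, Set.mem_ofPred_eq, not_or, not_not] at hcon
        exact hω hcon }
  suffices hL : Tendsto id L (𝓝 G) from fun U hU => hL hU
  rw [ProbabilityMeasure.tendsto_iff_forall_integral_tendsto]
  intro f
  have hmeas : ∀ n, AEStronglyMeasurable (fun ω => ∫ x, f x ∂(c n ω : Measure ℝ)) P := by
    intro n
    have h1 : StronglyMeasurable fun q : ℝ × ℝ => f q.2 :=
      (f.continuous.comp continuous_snd).stronglyMeasurable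
    have h2 : StronglyMeasurable fun w => ∫ x, f x ∂condDistrib (Z n) X P w :=
      h1.integral_kernel_prod_right'
    exact (h2.comp_measurable hX).aestronglyMeasurable
  have hae : ∀ᵐ ω ∂P, Tendsto (fun n => ∫ x, f x ∂(c n ω : Measure ℝ)) atTop
      (𝓝 (∫ x, f x ∂(G : Measure ℝ))) := by
    filter_upwards [h] with ω hω
    exact ProbabilityMeasure.tendsto_iff_forall_integral_tendsto.1 hω f
  have hprob := tendstoInMeasure_of_tendsto_ae hmeas hae
  rw [tendstoInMeasure_iff_dist] at hprob
  rw [Metric.tendsto_nhds]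
  intro ε hε
  change Tendsto (fun n => P {ω | ¬ dist (∫ x, f x ∂(c n ω : Measure ℝ)) _ < ε}) atTop (𝓝 0)
  simpa only [not_lt] using hprob ε hε

end ConvergenceInProbability

/-! ### Avoidance of null sets, for replacing `g` by a Borel version. -/

section ModifyFunction

variable {p : ℝ → ℝ} {hp : Measurable p} (hp01 : ∀ w, p w ∈ Set.Ioo (0 : ℝ) 1)
  {ν : Measure ℝ} [IsProbabilityMeasure ν]
  {Ω : Type*} [MeasurableSpace Ω] {P : Measure Ω} [IsProbabilityMeasure P]

include hp01 in
lemma IsMarkovChain.ae_state_notMem {W : ℕ → Ω → ℝ} {μ : Measure ℝ}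
    (hW : IsMarkovChain P W (stayOrJump p hp ν) μ) {N : Set ℝ} (hN : MeasurableSet N)
    (hμ : μ N = 0) (hν : ν N = 0) : ∀ᵐ ω ∂P, ∀ n, W n ω ∉ N := by
  have := isMarkovKernel_stayOrJump (hp := hp) (ν := ν) hp01
  refine ae_all_iff.2 fun n => hW.ae_notMem hN hμ (fun v hv => ?_) n
  change (ENNReal.ofReal (p v) • Measure.dirac v + ENNReal.ofReal (1 - p v) • ν) N = 0
  simp [hν, hv, Measure.dirac_apply' _ hN]

include hp01 in
lemma IsMarkovChain.ae_marked_state_notMem {V : ℕ → Ω → ℝ × Bool} {μ : Measure ℝ}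
    (hV : IsMarkovChain P V (markedStayOrJump p hp ν) (μ.map fun w => (w, false)))
    {N : Set ℝ} (hN : MeasurableSet N) (hμ : μ N = 0) (hν : ν N = 0) :
    ∀ᵐ ω ∂P, ∀ n, (V n ω).1 ∉ N := by
  have := isMarkovKernel_markedStayOrJump (hp := hp) (ν := ν) hp01
  have hN' : MeasurableSet (Prod.fst ⁻¹' N : Set (ℝ × Bool)) := measurable_fst hN
  refine ae_all_iff.2 fun n => hV.ae_notMem hN' ?_ (fun v hv => ?_) n
  · rw [Measure.map_apply (by fun_prop) hN']
    exact hμ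
  · have hv' : v.1 ∉ N := hv
    rw [← lintegral_indicator_one hN',
      lintegral_markedStayOrJump v (measurable_one.indicator hN')]
    have h2 : ∫⁻ z, (Prod.fst ⁻¹' N : Set (ℝ × Bool)).indicator (1 : ℝ × Bool → ℝ≥0∞) (z, true) ∂ν
        = 0 := by
      rw [← hν, ← lintegral_indicator_one hN]
      rfl
    rw [h2]
    simp [hv']

end ModifyFunction

end StayJump

end

/-! ### The main theorem. -/

/-- `W` is any stationary stay-or-jump chain. `V` is any realization of the chain together with
its jumps; it only serves to define the jump times, the block sums `Y_j` and `H`. One may take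
`V n = (W n, J n)` on the same probability space, with `J n` telling whether the step from `n - 1`
to `n` was a jump, which for `ν` without atoms means almost surely that `W n ≠ W (n - 1)`. -/
theorem proposition3p1
    (ν : Measure ℝ) [IsProbabilityMeasure ν]
    (p : ℝ → ℝ) (hp : Measurable p) (hp01 : ∀ w, p w ∈ Set.Ioo (0 : ℝ) 1)
    (hθ : Integrable (fun w => (1 - p w)⁻¹) ν)
    (g : ℝ → ℝ) (hg : MemLp g 2 (StayJump.stationaryLaw p ν))
    (hg0 : ∫ w, g w ∂(StayJump.stationaryLaw p ν) = 0)
    {Ω : Type*} [MeasurableSpace Ω] (P : Measure Ω) [IsProbabilityMeasure P]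
    (W : ℕ → Ω → ℝ)
    (hW : StayJump.IsMarkovChain P W (StayJump.stayOrJump p hp ν) (StayJump.stationaryLaw p ν))
    {Ω' : Type*} [MeasurableSpace Ω'] (P' : Measure Ω') [IsProbabilityMeasure P']
    (V : ℕ → Ω' → ℝ × Bool)
    (hV : StayJump.IsMarkovChain P' V (StayJump.markedStayOrJump p hp ν)
      ((StayJump.stationaryLaw p ν).map (fun w => (w, false))))
    (hH : StayJump.SlowlyVarying (StayJump.truncatedMoment P' V g))
    (γ : ℕ → ℝ) (hγ_top : Tendsto γ atTop atTop)
    (hγ : (fun m => γ m ^ 2) ~[atTop]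
      (fun m : ℕ => (m : ℝ) * StayJump.truncatedMoment P' V g (γ m))) :
    StayJump.CondLawTendstoInProb P (W 0)
      (fun n ω => StayJump.partialSum g W n ω / γ n)
      ⟨gaussianReal 0 (1 / StayJump.theta p ν).toNNReal, inferInstance⟩ := by
  open StayJump in
  set π := stationaryLaw p ν with hπ
  have hκ := isMarkovKernel_stayOrJump (hp := hp) (ν := ν) hp01
  have hfin : IsFiniteMeasure π := isFiniteMeasure_stationaryLaw ν hθ
  have hθ1 := one_le_theta hp01 ν hθ
  -- Replace `g` by a Borel function `f`.
  set f : ℝ → ℝ := hg.1.mk g with hf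
  have hfm : Measurable f := hg.1.stronglyMeasurable_mk.measurable
  have hgf : g =ᵐ[π] f := hg.1.ae_eq_mk
  obtain ⟨N, hNsub, hN, hπN⟩ := exists_measurable_superset_of_null (ae_iff.1 hgf)
  have hνN : ν N = 0 := absolutelyContinuous_stationaryLaw hp hp01 ν hθ hπN
  have hgfN : ∀ w ∉ N, g w = f w := fun w hw => by
    by_contra h
    exact hw (hNsub h)
  obtain ⟨hfi, hfint⟩ := integrable_and_integral_of_stationary hp hp01 ν hθ
    ((hg.integrable one_le_two).congr hgf)
  rw [← integral_congr_ae hgf, hg0, mul_zero] at hfint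
  -- The law of the block sums.
  have hblock : (fun ω => blockSum g (fun n => V n ω) 1) =ᵐ[P']
      fun ω => blockSum f (fun n => V n ω) 1 := by
    filter_upwards [hV.ae_marked_state_notMem hp01 hN hπN hνN] with ω hω
    simp only [blockSum, hgfN _ (hω _)]
  obtain ⟨hbm, hbl⟩ := hV.map_blockSum hp01 hfm
  have hmoment : truncatedMoment P' V g
      = fun y => ∫ x in {x : ℝ | |x| ≤ y}, x ^ 2 ∂blockLaw ν p hp f := by
    funext y
    rw [← hbl, ← Measure.map_congr hblock, setIntegral_map (measurableSet_abs_le y)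
      (by fun_prop) (hbm.congr hblock.symm)]
    rfl
  rw [hmoment] at hH hγ
  have hbprob := isProbabilityMeasure_blockLaw hp hp01 ν hfm
  have hYm : Measurable fun q : ℝ × ℕ => ((q.2 : ℝ) + 1) * f q.1 := by
    have := measurable_comp_snd (S := ℝ) fun k : ℕ => (k : ℝ)
    fun_prop
  have hbint : Integrable (fun x : ℝ => x) (blockLaw ν p hp f) := by
    rw [blockLaw, integrable_map_measure (by fun_prop) hYm.aemeasurable]
    exact integrable_block_sum hp hp01 ν hfm hfi
  have hbmean : ∫ x, x ∂blockLaw ν p hp f = 0 := by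
    rw [blockLaw, integral_map hYm.aemeasurable (by fun_prop),
      integral_block_sum hp hp01 ν hfm hfi, hfint]
  -- With `g = 1` the block sum is the block length, whose mean is `θ`.
  have hG : Integrable (fun q : ℝ × ℕ => (q.2 : ℝ) + 1) (ν ⊗ₘ geomKernel p hp) := by
    simpa using integrable_block_sum hp hp01 ν (g := fun _ => 1) measurable_const (by simpa)
  have hGint : ∫ q, ((q.2 : ℝ) + 1) ∂(ν ⊗ₘ geomKernel p hp) = theta p ν := by
    simpa [theta] using integral_block_sum hp hp01 ν (g := fun _ => 1) measurable_const (by simpa)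
  -- Convergence of the conditional laws from every starting point.
  set G : ProbabilityMeasure ℝ := ⟨gaussianReal 0 (1 / theta p ν).toNNReal, inferInstance⟩
  set η : ℕ → Kernel ℝ ℝ := fun n =>
    (sumKernel (stayOrJump p hp ν) f n).map fun x => (γ n)⁻¹ * x with hη
  have hηM : ∀ n, IsMarkovKernel (η n) := fun n => by
    have := isMarkovKernel_sumKernel (κ := stayOrJump p hp ν) hfm n
    exact Kernel.IsMarkovKernel.map _ (by fun_prop)
  have hlim : ∀ w, Tendsto (β := ProbabilityMeasure ℝ)
      (fun n => ⟨η n w, inferInstance⟩) atTop (𝓝 G) := by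
    intro w
    refine ProbabilityMeasure.tendsto_iff_tendsto_charFun.2 fun t => ?_
    have hs : Tendsto (fun n => t / γ n) atTop (𝓝 0) := hγ_top.const_div_atTop t
    have hclt := tendsto_mul_charFun_sub_one hbint hbmean hH hγ_top hγ t
    -- This `β` satisfies `βθ = t²/2`, the exponent of the block limit theorem, and `exp(-β)` is the
    -- characteristic function of the limit at `t`.
    have hβ : 0 ≤ t ^ 2 / (2 * theta p ν) := by positivity
    have h := tendsto_charFun_sumKernel hp hp01 ν hfm hG hβ hs (by
      rw [hGint]
      convert hclt using 4
      field_simp) w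
    convert h using 2
    · simp only [ProbabilityMeasure.coe_mk, hη]
      rw [Kernel.map_apply _ (by fun_prop), charFun_map_mul, inv_mul_eq_div]
    · change charFun (gaussianReal 0 _) t = _
      rw [charFun_gaussianReal, Real.coe_toNNReal _ (by positivity)]
      congr 1
      push_cast
      field_simp
      ring
  have hcond : ∀ n, ∀ᵐ ω ∂P,
      condDistrib (fun ω => partialSum g W n ω / γ n) (W 0) P (W 0 ω) = η n (W 0 ω) := by
    intro n
    have hM := isMarkovKernel_sumKernel (κ := stayOrJump p hp ν) hfm n
    have hSm : Measurable (partialSum f W n) :=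
      (measurable_partialSum_pastSigma hfm W n).mono (hW.pastSigma_le n) le_rfl
    have hSeq : (fun ω => partialSum g W n ω / γ n)
        =ᵐ[P] fun ω => (γ n)⁻¹ * partialSum f W n ω := by
      filter_upwards [hW.ae_state_notMem hp01 hN hπN hνN] with ω hω
      rw [inv_mul_eq_div, partialSum, partialSum,
        Finset.sum_congr rfl fun k _ => hgfN _ (hω k)]
    rw [condDistrib_congr_left hSeq]
    -- The conditional law is identified by uniqueness of disintegration from the joint law of `W_0`
    -- and the sum.
    refine ae_of_ae_map (hW.measurable 0).aemeasurable
      (condDistrib_ae_eq_of_measure_eq_compProd (W 0) (by fun_prop) ?_)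
    rw [hη, Measure.compProd_map (by fun_prop), ← hW.map_partialSum hfm n,
      Measure.map_map (by fun_prop) ((hW.measurable 0).prodMk hSm)]
    rfl
  refine condLawTendstoInProb_of_ae (hW.measurable 0) ?_
  -- Countably many `n` share one null set, outside which the limit at the starting point `W 0 ω`
  -- applies.
  filter_upwards [ae_all_iff.2 hcond] with ω hω
  refine (hlim (W 0 ω)).congr fun n => Subtype.ext (hω n).symm
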